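/- Let $A$ be a finite alphabet, let $W_A$ be the free monoid of words on $A$ with empty word $e$, and let $\mathcal{A}$ be the real vector space with basis $W_A$, with concatenation product and with the pairing $\langle\cdot,\cdot\rangle$ for which words are orthonormal. The half shuffle $\prec$ is the bilinear product on $\mathcal{A}$ with $e\prec v=0$ for all words $v$, $u\prec e=u$ for words $u\neq e$, and $(au)\prec v=a(u\prec v+v\prec u)$ for $a\in A$ and words $u,v$ with $v\ne e$. Let $\mathcal{M}_A$ be the free magma on $A$ (planar binary trees with leaves in $A$). For $t\in\mathcal{M}_A$ let $f(t)\in W_A$ be its foliage, so that $f(a)=a$ and $f((t',t''))=f(t')f(t'')$, and let $[t]\in\mathcal{A}$ be its Lie bracketing, so that $[a]=a$ and $[(t',t'')]=[t'][t'']-[t''][t']$. A Hall set is a subset $H\subset\mathcal{M}_A$ with a total order $<$ such that $A\subset H$; $(t',t'')<t''$ whenever $(t',t''),t''\in H$; and, for all $h_1,h_2\in\mathcal{M}_A$, $(h_1,h_2)\in H$ if and only if $h_1,h_2\in H$, $h_1<h_2$, and either $h_1\in A$ or $h_1=(h_1',h_1'')$ with $h_2\le h_1''$. Let $H$ be a Hall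 set. A family $(S_w)_{w\in W_A}$ in $\mathcal{A}$ is called dual to the Poincaré–Birkhoff–Witt basis of $H$ if for every word $u$ and every finite sequence $g_1\ge\dots\ge g_m$ in $H$ ($m\ge0$), the number $\langle S_u,[g_1]\cdots[g_m]\rangle$ equals $1$ if $u=f(g_1)\cdots f(g_m)$ and $0$ otherwise. Then there is exactly one such dual family $(S_w)_{w\in W_A}$, and for every Hall tree $h=(h',h'')\in H$ of degree $\ge 2$ it satisfies $$S_{f(h)}=\alpha_h\,\bigl(S_{f(h')}\prec S_{f(h'')}\bigr),$$ where $\alpha_h=1/k$ is the Lazard depth of $h$: here $k\ge1$ is the integer for which $h=(\dots((h_1,h_2),h_2),\dots,h_2)$ with $k$ copies of $h_2$, and $h_1$ is either a letter or a tree $(h_1',h_1'')$ with $h_1''\neq h_2$. -/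

import Mathlib

noncomputable section

namespace HallShuffle

/-- The tensor algebra over the alphabet `A`: real linear combinations of words in `A`, with
concatenation as product. -/
abbrev WordAlg (A : Type*) := MonoidAlgebra ℝ (FreeMonoid A)

/-- A word, seen as an element of the word algebra. -/
def ofWord {A : Type*} (w : FreeMonoid A) : WordAlg A := MonoidAlgebra.single w 1

/-- The pairing on the word algebra for which the words are orthonormal. -/
def pairing {A : Type*} (f g : WordAlg A) : ℝ :=
  f.coeff.sum fun w x => x * g.coeff w

/-! ### The half shuffle product -/

/-- The left half shuffle of two words: `e ≺ v = 0`, `u ≺ e = u` for `u ≠ e`, and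
`(a u) ≺ v = a (u ≺ v + v ≺ u)` for a letter `a` and a nonempty word `v`. -/
def halfShuffleWord {A : Type*} : List A → List A → WordAlg A
  | [], _ => 0
  | a :: u, [] => ofWord (FreeMonoid.ofList (a :: u))
  | a :: u, b :: v =>
      ofWord (FreeMonoid.of a) * (halfShuffleWord u (b :: v) + halfShuffleWord (b :: v) u)
termination_by u v => u.length + v.length

/-- The left half shuffle product `f ≺ g`, the bilinear extension of the one on words. -/
def halfShuffle {A : Type*} (f g : WordAlg A) : WordAlg A :=
  f.coeff.sum fun u x => g.coeff.sum fun v y =>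
    (x * y) • halfShuffleWord (FreeMonoid.toList u) (FreeMonoid.toList v)

/-! ### Trees and Hall sets

Trees are elements of the free magma `FreeMagma A`, and `s * t` is the tree `(s, t)`. -/

/-- The foliage of a tree: the word read off its leaves. -/
def foliage {A : Type*} : FreeMagma A → FreeMonoid A :=
  FreeMagma.lift FreeMonoid.of

/-- The Lie bracketing `[t]` of a tree in the word algebra. -/
def bracketing {A : Type*} : FreeMagma A → WordAlg A
  | .of a => ofWord (FreeMonoid.of a)
  | .mul s t => bracketing s * bracketing t - bracketing t * bracketing s

/-- `H`, totally ordered by (the restriction to `H` of) the strict order `lt`, is a Hall set. -/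
structure IsHallSet {A : Type*} (H : Set (FreeMagma A))
    (lt : FreeMagma A → FreeMagma A → Prop) : Prop where
  irrefl : ∀ s ∈ H, ¬ lt s s
  trans : ∀ r ∈ H, ∀ s ∈ H, ∀ t ∈ H, lt r s → lt s t → lt r t
  total : ∀ s ∈ H, ∀ t ∈ H, lt s t ∨ s = t ∨ lt t s
  /-- The order is ancestral: `(s, t) < t`. -/
  ancestral : ∀ s t, s * t ∈ H → t ∈ H → lt (s * t) t
  letter_mem : ∀ a, FreeMagma.of a ∈ H
  /-- `(s, t)` is a Hall tree iff `s` and `t` are, `s < t`, and either `s` is a letter or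
  `s = (s', s'')` with `t ≤ s''`. -/
  mul_mem_iff : ∀ s t, s * t ∈ H ↔
    s ∈ H ∧ t ∈ H ∧ lt s t ∧
      ((∃ a, s = FreeMagma.of a) ∨ ∃ s' s'', s = s' * s'' ∧ (lt t s'' ∨ t = s''))

/-! ### The Poincaré–Birkhoff–Witt basis and its dual -/

/-- A (weakly) decreasing finite sequence of Hall trees. Grouping equal terms, these are the
sequences `h₁, …, h₁, …, hₙ, …, hₙ` with `h₁ > ⋯ > hₙ` in `H`. -/
def IsDecreasing {A : Type*} (H : Set (FreeMagma A)) (lt : FreeMagma A → FreeMagma A → Prop)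
    (l : List (FreeMagma A)) : Prop :=
  (∀ h ∈ l, h ∈ H) ∧ l.Pairwise fun s t => lt t s ∨ s = t

/-- The product of the foliages of a sequence of trees. -/
def foliageProd {A : Type*} (l : List (FreeMagma A)) : FreeMonoid A := (l.map foliage).prod

/-- The product of the Lie bracketings of a sequence of trees. For a decreasing sequence `l` of
Hall trees it is the Poincaré–Birkhoff–Witt basis element `P_w` of the word
`w = foliageProd l`. -/
def pbwProd {A : Type*} (l : List (FreeMagma A)) : WordAlg A := (l.map bracketing).prod

/-- The family `S`, indexed by words, is dual to the Poincaré–Birkhoff–Witt basis of `H`: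
`⟨S_u, P_w⟩` is `1` if `u = w` and `0` otherwise. -/
def IsDualPBW {A : Type*} (H : Set (FreeMagma A)) (lt : FreeMagma A → FreeMagma A → Prop)
    (S : FreeMonoid A → WordAlg A) : Prop :=
  ∀ (u w : FreeMonoid A) (l : List (FreeMagma A)), IsDecreasing H lt l → foliageProd l = w →
    (u = w → pairing (S u) (pbwProd l) = 1) ∧ (u ≠ w → pairing (S u) (pbwProd l) = 0)

/-! ### The Lazard depth -/

/-- The tree `(s t^k) = (…((s, t), t), …, t)`, with `k` copies of `t`. -/
def rightPow {A : Type*} (s t : FreeMagma A) : ℕ → FreeMagma A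
  | 0 => s
  | k + 1 => rightPow s t k * t

open Classical in
/-- The largest `k` such that the tree has the form `(s t^k)`, for the given `t`. -/
def rightMultiplicity {A : Type*} (t : FreeMagma A) : FreeMagma A → ℕ
  | .of _ => 0
  | .mul x y => if y = t then rightMultiplicity t x + 1 else 0

/-- The exponent `k` of the Lazard decomposition `h = (h₁ h₂^k)`, in which `h₁` is a letter or
`h₁ = (h₁', h₁'')` with `h₁'' ≠ h₂`. (It is `0` by convention if `h` is a letter.) -/
def lazardExponent {A : Type*} : FreeMagma A → ℕ
  | .of _ => 0
  | .mul x y => rightMultiplicity y (.mul x y)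

/-- The Lazard depth `α_h = 1 / k` of a tree `h` of degree at least two. -/
def lazardDepth {A : Type*} (h : FreeMagma A) : ℚ := 1 / (lazardExponent h : ℚ)

theorem rightMultiplicity_rightPow {A : Type*} (s t : FreeMagma A)
    (hs : ∀ x, s ≠ x * t) (k : ℕ) : rightMultiplicity t (rightPow s t k) = k := by
  induction k with
  | zero =>
    cases s with
    | of a => rfl
    | mul x y =>
      have hy : y ≠ t := fun h => hs x (by rw [h]; rfl)
      simp only [rightPow, rightMultiplicity, if_neg hy]
  | succ k ih =>
    change rightMultiplicity t (.mul (rightPow s t k) t) = k + 1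
    simp only [rightMultiplicity, if_true, ih]

/-- The Lazard exponent is the `k` of any Lazard decomposition. -/
theorem lazardExponent_rightPow {A : Type*} (s t : FreeMagma A)
    (hs : ∀ x, s ≠ x * t) (k : ℕ) (hk : 0 < k) : lazardExponent (rightPow s t k) = k := by
  obtain ⟨k, rfl⟩ := Nat.exists_eq_succ_of_ne_zero hk.ne'
  exact rightMultiplicity_rightPow s t hs (k + 1)

end HallShuffle

end

noncomputable section

namespace HallShuffle

set_option linter.unusedSectionVars false

section

/-! ### The shuffle algebra of functions on words -/

/-! Let `R` be the word algebra, and give functions from words to `R` the shuffle convolution, so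
that `scal f * const x` plays the role of f ⊗ x. Define S_h on trees by the asserted recursion
(`dualTree`). The core is the factorization of the series Σ w ⊗ w, that is of the function w ↦ w, as
the product of exp(S_h ⊗ [h]) over all Hall trees in decreasing order
(`IsHallList.treeExpProd_apply`).

Deleting the first letter a is a derivation D_a of the shuffle algebra, and Σ w ⊗ w is the only
series E with constant term 1 and D_a E = aE for all a. So it suffices to find the logarithmic
derivative of the product, which Lazard elimination provides. The product over a lower set r of Hall
trees has logarithmic derivative Σ D_a S_t ⊗ [t], over those t in r whose right child is not in r
(`D_treeExpProd`). When a new largest tree c is put in front, conjugation by exp(S_c ⊗ [c]) gathers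
all terms of trees (z c^k) into the single term of z. This works because D_a S_{(z c^k)} = D_a S_z ·
S_c^k / k!, where the Lazard depths supply the factorial (`D_dualFun_rightPow`). Once r is
everything, only letters are left, and the logarithmic derivative is a. Infinite products are
avoided by bounding the degree of trees by N and comparing values on short words only.

Expanding the exponentials writes each word in decreasing products of Hall brackets, with divided
shuffle powers of the S_h as coefficients (`IsHallList.ofWord_eq_sum`). Pairing with this expansion
determines a dual family. For the word f(h) a single term survives, with coefficient S_h, because
decreasing factorizations into Hall words are unique (`IsDecreasing.eq_of_foliageProd_eq`).
Existence (`exists_dual`) is linear algebra in each degree: the expansion gives a one-sided inverse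
matrix, and unique factorization makes it square. -/

/-- Functions on words with values in `R`; the product is the shuffle convolution. -/
def WordFun (A R : Type*) := List A → R

namespace WordFun

variable {A R : Type*}

@[ext]
theorem ext {f g : WordFun A R} (h : ∀ w, f w = g w) : f = g := funext h

/-- The derivation of the shuffle algebra removing the first letter `a`. -/
def D (a : A) (f : WordFun A R) : WordFun A R := fun w => f (a :: w)

theorem D_apply (a : A) (f : WordFun A R) (w : List A) : D a f w = f (a :: w) := rfl

theorem ext_D {f g : WordFun A R} (h0 : f [] = g []) (h : ∀ a, D a f = D a g) : f = g := by
  ext w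
  cases w with
  | nil => exact h0
  | cons a w => exact congrFun (h a) w

variable [Ring R] [Algebra ℝ R]

instance : AddCommGroup (WordFun A R) := inferInstanceAs (AddCommGroup (List A → R))
instance : Module ℝ (WordFun A R) := inferInstanceAs (Module ℝ (List A → R))

@[simp] theorem add_apply (f g : WordFun A R) (w : List A) : (f + g) w = f w + g w := rfl
@[simp] theorem sub_apply (f g : WordFun A R) (w : List A) : (f - g) w = f w - g w := rfl
@[simp] theorem zero_apply (w : List A) : (0 : WordFun A R) w = 0 := rfl
@[simp] theorem smul_apply (c : ℝ) (f : WordFun A R) (w : List A) : (c • f) w = c • f w := rfl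

@[simp] theorem D_add (a : A) (f g : WordFun A R) : D a (f + g) = D a f + D a g := rfl
@[simp] theorem D_zero (a : A) : D a (0 : WordFun A R) = 0 := rfl
@[simp] theorem D_smul (a : A) (c : ℝ) (f : WordFun A R) : D a (c • f) = c • D a f := rfl

/-- The value of the shuffle convolution of two functions at a word. -/
def shuffleAt : List A → WordFun A R → WordFun A R → R
  | [], f, g => f [] * g []
  | a :: w, f, g => shuffleAt w (D a f) g + shuffleAt w f (D a g)

instance : Mul (WordFun A R) := ⟨fun f g w => shuffleAt w f g⟩

/-- The function with value `x` at the empty word and `0` elsewhere. -/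
def const (x : R) : WordFun A R
  | [] => x
  | _ :: _ => 0

instance : One (WordFun A R) := ⟨const 1⟩

theorem mul_nil (f g : WordFun A R) : (f * g) [] = f [] * g [] := rfl
theorem D_mul (a : A) (f g : WordFun A R) : D a (f * g) = D a f * g + f * D a g := rfl
theorem one_nil : (1 : WordFun A R) [] = 1 := rfl
@[simp] theorem D_const (a : A) (x : R) : D a (const x) = 0 := rfl
@[simp] theorem D_one (a : A) : D a (1 : WordFun A R) = 0 := rfl

theorem mul_cons (f g : WordFun A R) (a : A) (w : List A) :
    (f * g) (a :: w) = (D a f * g) w + (f * D a g) w := rfl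

/-- The ring axioms are checked word by word, by induction with the functions left free: the Leibniz
rule `mul_cons` reduces a product at a longer word to products of derivatives at a shorter one. -/
theorem zero_mul_apply (f : WordFun A R) (w : List A) : ((0 : WordFun A R) * f) w = 0 := by
  induction w generalizing f with
  | nil => simp [mul_nil]
  | cons a w ih => rw [mul_cons, D_zero, ih, ih, add_zero]

theorem mul_zero_apply (f : WordFun A R) (w : List A) : (f * (0 : WordFun A R)) w = 0 := by
  induction w generalizing f with
  | nil => simp [mul_nil]
  | cons a w ih => rw [mul_cons, D_zero, ih, ih, add_zero]

theorem add_mul_apply (f g h : WordFun A R) (w : List A) :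
    ((f + g) * h) w = (f * h) w + (g * h) w := by
  induction w generalizing f g h with
  | nil => simp [mul_nil, add_mul]
  | cons a w ih => simp only [mul_cons, D_add, ih]; abel

theorem mul_add_apply (f g h : WordFun A R) (w : List A) :
    (f * (g + h)) w = (f * g) w + (f * h) w := by
  induction w generalizing f g h with
  | nil => simp [mul_nil, mul_add]
  | cons a w ih => simp only [mul_cons, D_add, ih]; abel

theorem smul_mul_apply (c : ℝ) (f g : WordFun A R) (w : List A) :
    ((c • f) * g) w = c • (f * g) w := by
  induction w generalizing f g with
  | nil => simp [mul_nil]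
  | cons a w ih => simp only [mul_cons, D_smul, ih, smul_add]

theorem mul_smul_apply (c : ℝ) (f g : WordFun A R) (w : List A) :
    (f * (c • g)) w = c • (f * g) w := by
  induction w generalizing f g with
  | nil => simp [mul_nil]
  | cons a w ih => simp only [mul_cons, D_smul, ih, smul_add]

theorem mul_assoc_apply (f g h : WordFun A R) (w : List A) :
    (f * g * h) w = (f * (g * h)) w := by
  induction w generalizing f g h with
  | nil => simp [mul_nil, mul_assoc]
  | cons a w ih => simp only [mul_cons, D_mul, add_mul_apply, mul_add_apply, ih]; abel

theorem one_mul_apply (f : WordFun A R) (w : List A) : (1 * f) w = f w := by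
  induction w generalizing f with
  | nil => simp [mul_nil, one_nil]
  | cons a w ih => rw [mul_cons, D_one, zero_mul_apply, ih, zero_add, D_apply]

theorem mul_one_apply (f : WordFun A R) (w : List A) : (f * 1) w = f w := by
  induction w generalizing f with
  | nil => simp [mul_nil, one_nil]
  | cons a w ih => rw [mul_cons, D_one, mul_zero_apply, ih, add_zero, D_apply]

instance : Ring (WordFun A R) :=
  { (inferInstance : AddCommGroup (WordFun A R)) with
    mul := (· * ·)
    one := 1
    zero_mul := fun f => ext (zero_mul_apply f)
    mul_zero := fun f => ext (mul_zero_apply f)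
    left_distrib := fun f g h => ext (mul_add_apply f g h)
    right_distrib := fun f g h => ext (add_mul_apply f g h)
    mul_assoc := fun f g h => ext (mul_assoc_apply f g h)
    one_mul := fun f => ext (one_mul_apply f)
    mul_one := fun f => ext (mul_one_apply f) }

instance : Algebra ℝ (WordFun A R) :=
  Algebra.ofModule (fun c f g => ext (smul_mul_apply c f g)) (fun c f g => ext (mul_smul_apply c f g))

/-- `D a` as a linear map. -/
def DLin (a : A) : WordFun A R →ₗ[ℝ] WordFun A R where
  toFun := D a
  map_add' _ _ := rfl
  map_smul' _ _ := rfl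

theorem D_sum {ι : Type*} (a : A) (s : Finset ι) (f : ι → WordFun A R) :
    D a (∑ i ∈ s, f i) = ∑ i ∈ s, D a (f i) := map_sum (DLin a) f s

/-- Evaluation at a word. -/
def evalLin (w : List A) : WordFun A R →ₗ[ℝ] R where
  toFun f := f w
  map_add' _ _ := rfl
  map_smul' _ _ := rfl

theorem sum_apply {ι : Type*} (s : Finset ι) (f : ι → WordFun A R) (w : List A) :
    (∑ i ∈ s, f i) w = ∑ i ∈ s, f i w := map_sum (evalLin w) f s

/-- Values may fail to commute, so the power rule needs `f` to commute with its own derivative. -/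
theorem D_pow_succ {f : WordFun A R} {a : A} (h : Commute (D a f) f) (k : ℕ) :
    D a (f ^ (k + 1)) = ((k + 1 : ℕ) : ℝ) • (D a f * f ^ k) := by
  induction k with
  | zero => simp
  | succ k ih =>
    rw [pow_succ, D_mul, ih, (h.symm.pow_left (k + 1)).eq, smul_mul_assoc, mul_assoc, ← pow_succ,
      Nat.cast_succ (k + 1), add_smul, one_smul]

/-! ### Constants and scalar functions -/

theorem const_mul_apply (x : R) (f : WordFun A R) (w : List A) :
    (const x * f : WordFun A R) w = x * f w := by
  induction w generalizing f with
  | nil => rfl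
  | cons a w ih => rw [mul_cons, D_const, zero_mul, ih, zero_apply, zero_add, D_apply]

theorem const_mul (x y : R) : (const (x * y) : WordFun A R) = const x * const y := by
  ext w
  rw [const_mul_apply]
  cases w <;> simp [const]

theorem const_one : (const 1 : WordFun A R) = 1 := rfl

theorem const_pow (x : R) (k : ℕ) : (const (x ^ k) : WordFun A R) = const x ^ k := by
  induction k with
  | zero => simp [const_one]
  | succ k ih => rw [pow_succ, const_mul, ih, pow_succ]

/-- A real-valued function seen as a function with values in `R`. -/
def scal (f : WordFun A ℝ) : WordFun A R := fun w => algebraMap ℝ R (f w)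

@[simp] theorem D_scal (a : A) (f : WordFun A ℝ) : D a (scal f : WordFun A R) = scal (D a f) := rfl

theorem scal_mul (f g : WordFun A ℝ) : (scal (f * g) : WordFun A R) = scal f * scal g := by
  ext w
  induction w generalizing f g with
  | nil => simp [scal, mul_nil]
  | cons a w ih =>
    rw [mul_cons, D_scal, D_scal, ← ih, ← ih, scal, mul_cons, map_add]; rfl

theorem scal_one : (scal 1 : WordFun A R) = 1 := by
  ext w
  cases w
  · simp [scal, one_nil]
  · exact map_zero _

theorem scal_smul (c : ℝ) (f : WordFun A ℝ) : (scal (c • f) : WordFun A R) = c • scal f := by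
  ext w
  simp [scal, Algebra.smul_def]

theorem scal_pow (f : WordFun A ℝ) (k : ℕ) : (scal (f ^ k) : WordFun A R) = scal f ^ k := by
  induction k with
  | zero => simp [scal_one]
  | succ k ih => rw [pow_succ, scal_mul, ih, pow_succ]

/-- Interchanging the factors permutes the two Leibniz terms, so only the values have to commute,
and real scalars are central. -/
theorem scal_commute (f : WordFun A ℝ) (g : WordFun A R) : Commute (scal f) g := by
  ext w
  induction w generalizing f g with
  | nil => exact Algebra.commutes _ _
  | cons a w ih =>
    rw [mul_cons, mul_cons, D_scal, ih, ih, add_comm]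

theorem scal_mul_const_apply (f : WordFun A ℝ) (x : R) (w : List A) :
    (scal f * const x : WordFun A R) w = f w • x := by
  rw [(scal_commute f _).eq, const_mul_apply, scal, Algebra.smul_def, Algebra.commutes]

/-! ### Order of vanishing and congruence -/

/-- `f` vanishes on words of length less than `n`. -/
def Vanish (n : ℕ) (f : WordFun A R) : Prop := ∀ w, w.length < n → f w = 0

theorem Vanish.mul {m n : ℕ} {f g : WordFun A R} (hf : Vanish m f) (hg : Vanish n g) :
    Vanish (m + n) (f * g) := by
  intro w
  induction w generalizing f g m n with
  | nil =>
    intro h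
    rw [mul_nil]
    rcases Nat.eq_zero_or_pos m with rfl | hm
    · rw [hg [] (by simpa using h), mul_zero]
    · rw [hf [] (by simpa using hm), zero_mul]
  | cons a w ih =>
    intro h
    -- The subtraction `p - 1` is truncated, so an order 0 does not drop under `D a`; hence the case
    -- splits on `m` and `n` below.
    have hD : ∀ {p : ℕ} {k : WordFun A R}, Vanish p k → Vanish (p - 1) (D a k) :=
      fun hk v hv => hk (a :: v) (by simp only [List.length_cons]; omega)
    rw [mul_cons]
    simp only [List.length_cons] at h
    rcases Nat.eq_zero_or_pos m with rfl | hm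
    · rcases Nat.eq_zero_or_pos n with rfl | hn
      · omega
      · rw [ih (fun v hv => absurd hv (by omega) : Vanish 0 (D a f)) hg, ih hf (hD hg), add_zero] <;> omega
    · rw [ih (hD hf) hg (by omega)]
      rcases Nat.eq_zero_or_pos n with rfl | hn
      · rw [ih hf (fun v hv => absurd hv (by omega) : Vanish 0 (D a g)) (by omega), add_zero]
      · rw [ih hf (hD hg) (by omega), add_zero]

end WordFun

end

section

namespace WordFun

variable {A R : Type*} [Ring R] [Algebra ℝ R]

theorem vanish_zero (f : WordFun A R) : Vanish 0 f := fun _ h => absurd h (by omega)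

theorem Vanish.mono {m n : ℕ} {f : WordFun A R} (h : Vanish n f) (hmn : m ≤ n) : Vanish m f :=
  fun w hw => h w (hw.trans_le hmn)

theorem Vanish.mul_right {n : ℕ} {f : WordFun A R} (h : Vanish n f) (g : WordFun A R) :
    Vanish n (f * g) := h.mul (vanish_zero g)

theorem Vanish.mul_left {n : ℕ} {f : WordFun A R} (h : Vanish n f) (g : WordFun A R) :
    Vanish n (g * f) := by
  simpa using (vanish_zero g).mul h

theorem Vanish.smul {n : ℕ} {f : WordFun A R} (h : Vanish n f) (c : ℝ) : Vanish n (c • f) :=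
  fun w hw => by rw [smul_apply, h w hw, smul_zero]

theorem Vanish.pow {f : WordFun A R} (h : Vanish 1 f) (k : ℕ) : Vanish k (f ^ k) := by
  induction k with
  | zero => exact vanish_zero _
  | succ k ih => rw [pow_succ]; exact ih.mul h

theorem Vanish.scal {n : ℕ} {f : WordFun A ℝ} (h : Vanish n f) :
    Vanish n (WordFun.scal f : WordFun A R) :=
  fun w hw => by rw [WordFun.scal, h w hw, map_zero]

/-- `f` and `g` agree on words of length less than `n`. -/
def Cong (n : ℕ) (f g : WordFun A R) : Prop := ∀ w, w.length < n → f w = g w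

theorem Cong.refl (n : ℕ) (f : WordFun A R) : Cong n f f := fun _ _ => rfl

theorem Cong.symm {n : ℕ} {f g : WordFun A R} (h : Cong n f g) : Cong n g f :=
  fun w hw => (h w hw).symm

theorem Cong.trans {n : ℕ} {f g k : WordFun A R} (h : Cong n f g) (h' : Cong n g k) : Cong n f k :=
  fun w hw => (h w hw).trans (h' w hw)

theorem Cong.add {n : ℕ} {f g f' g' : WordFun A R} (h : Cong n f g) (h' : Cong n f' g') :
    Cong n (f + f') (g + g') :=
  fun w hw => by rw [add_apply, add_apply, h w hw, h' w hw]

/-- Functions vanishing to order `n` form a two-sided ideal. -/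
theorem Cong.mul {n : ℕ} {f g f' g' : WordFun A R} (h : Cong n f g) (h' : Cong n f' g') :
    Cong n (f * f') (g * g') := by
  have h1 : Vanish n (f - g) := fun w hw => by rw [sub_apply, h w hw, sub_self]
  have h2 : Vanish n (f' - g') := fun w hw => by rw [sub_apply, h' w hw, sub_self]
  intro w hw
  have h3 := (h1.mul_right f') w hw
  have h4 := (h2.mul_left g) w hw
  rw [sub_mul, sub_apply] at h3
  rw [mul_sub, sub_apply] at h4
  exact (sub_eq_zero.1 h3).trans (sub_eq_zero.1 h4)

theorem Cong.sum {ι : Type*} {n : ℕ} {s : Finset ι} {f g : ι → WordFun A R}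
    (h : ∀ i ∈ s, Cong n (f i) (g i)) : Cong n (∑ i ∈ s, f i) (∑ i ∈ s, g i) :=
  fun w hw => by
    rw [sum_apply, sum_apply]
    exact Finset.sum_congr rfl fun i hi => h i hi w hw

theorem cong_sum_subset {ι : Type*} {n : ℕ} {s t : Finset ι} {f : ι → WordFun A R} (hst : s ⊆ t)
    (h : ∀ i ∈ t, i ∉ s → Vanish n (f i)) : Cong n (∑ i ∈ s, f i) (∑ i ∈ t, f i) :=
  fun w hw => by
    rw [sum_apply, sum_apply]
    exact Finset.sum_subset hst fun i hi his => h i hi his w hw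

/-! ### Truncated exponentials -/

/-- The exponential series, truncated after the term of degree `N`. -/
def expTrunc (N : ℕ) (f : WordFun A R) : WordFun A R :=
  ∑ k ∈ Finset.range (N + 1), ((k.factorial : ℝ)⁻¹) • f ^ k

theorem expTrunc_nil (N : ℕ) {f : WordFun A R} (h : Vanish 1 f) : expTrunc N f [] = 1 := by
  rw [expTrunc, sum_apply, Finset.sum_range_succ', Finset.sum_eq_zero]
  · simp [one_nil]
  · intro k _
    rw [smul_apply, (h.pow (k + 1)) [] (by simp), smul_zero]

/-- Differentiation shortens the truncated series by one term; the missing one contains `f ^ N`,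
which vanishes on words shorter than `N`. -/
theorem D_expTrunc (N : ℕ) (a : A) {f : WordFun A R} (hc : Commute (D a f) f) (h : Vanish 1 f) :
    Cong N (D a (expTrunc N f)) (D a f * expTrunc N f) := by
  have h1 : D a (expTrunc N f) =
      D a f * ∑ k ∈ Finset.range N, ((k.factorial : ℝ)⁻¹) • f ^ k := by
    rw [expTrunc, Finset.sum_range_succ', D_add, D_sum, Finset.mul_sum]
    simp only [pow_zero, D_smul, D_one, smul_zero, add_zero, D_pow_succ hc]
    refine Finset.sum_congr rfl fun k _ => ?_
    rw [smul_smul, mul_smul_comm, Nat.factorial_succ, Nat.cast_mul, mul_inv, mul_right_comm,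
      inv_mul_cancel₀ (by positivity), one_mul]
  rw [h1, expTrunc, Finset.sum_range_succ, mul_add]
  intro w hw
  rw [add_apply, (((h.pow N).smul _).mul_left _) w hw, add_zero]

end WordFun

open WordFun

variable {A : Type*}

/-! ### Conjugation of a bracket by an exponential -/

theorem bracketing_mul (s t : FreeMagma A) :
    bracketing (s * t) = bracketing s * bracketing t - bracketing t * bracketing s := rfl

/-- With `L` and `M` the left and right multiplications by [c], the bracket of (z c^k) is (M - L)^k
[z]. Since `L` and `M` commute, this is the binomial theorem for M = L + (M - L). -/
theorem sum_choose_bracketing_rightPow (z c : FreeMagma A) (n : ℕ) :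
    ∑ m ∈ Finset.HasAntidiagonal.antidiagonal n,
      n.choose m.1 • (bracketing c ^ m.1 * bracketing (rightPow z c m.2)) =
      bracketing z * bracketing c ^ n := by
  set x := bracketing c
  let L : Module.End ℝ (WordAlg A) := LinearMap.mulLeft ℝ x
  let M : Module.End ℝ (WordAlg A) := LinearMap.mulRight ℝ x
  have hLM : Commute L M := LinearMap.commute_mulLeft_right _ _
  have hL : ∀ (k : ℕ) (y : WordAlg A), (L ^ k) y = x ^ k * y := by
    intro k y
    rw [LinearMap.pow_mulLeft]; rfl
  have hM : ∀ (k : ℕ) (y : WordAlg A), (M ^ k) y = y * x ^ k := by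
    intro k y
    rw [LinearMap.pow_mulRight]; rfl
  have hR : ∀ k, bracketing (rightPow z c k) = ((M - L) ^ k) (bracketing z) := by
    intro k
    induction k with
    | zero => rfl
    | succ k ih =>
      rw [rightPow, bracketing_mul, ih, pow_succ']; rfl
  have h := (Commute.add_pow' (x := L) (y := M - L)
    (hLM.sub_right (Commute.refl L)) n)
  rw [add_sub_cancel] at h
  have h2 := congrArg (fun f : Module.End ℝ (WordAlg A) => f (bracketing z)) h
  simp only [hM] at h2
  rw [h2, LinearMap.sum_apply]
  refine Finset.sum_congr rfl fun m _ => ?_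
  rw [LinearMap.smul_apply, Module.End.mul_apply, hL, hR]

/-- Conjugation of `[z]` by the exponential of `s [c]` expands into the trees `(z c^k)`. -/
theorem expTrunc_mul_sum_rightPow (N : ℕ) (z c : FreeMagma A) {f : WordFun A ℝ}
    (hf : Vanish 1 f) :
    Cong N
      (expTrunc N (scal f * const (bracketing c)) *
        ∑ k ∈ Finset.range (N + 1), ((k.factorial : ℝ)⁻¹) •
          (scal (f ^ k) * const (bracketing (rightPow z c k))))
      (const (bracketing z) * expTrunc N (scal f * const (bracketing c))) := by
  set x := bracketing c
  have hpow : ∀ k, (scal f * const x : WordFun A (WordAlg A)) ^ k = scal (f ^ k) * const (x ^ k) := by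
    intro k
    rw [(scal_commute f _).mul_pow, scal_pow, const_pow]
  let G : ℕ × ℕ → WordFun A (WordAlg A) := fun p =>
    ((p.1.factorial : ℝ)⁻¹ * (p.2.factorial : ℝ)⁻¹) •
      (scal (f ^ (p.1 + p.2)) * const (x ^ p.1 * bracketing (rightPow z c p.2)))
  have h1 : expTrunc N (scal f * const x) *
        ∑ k ∈ Finset.range (N + 1), ((k.factorial : ℝ)⁻¹) •
          (scal (f ^ k) * const (bracketing (rightPow z c k))) =
      ∑ p ∈ Finset.range (N + 1) ×ˢ Finset.range (N + 1), G p := by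
    rw [expTrunc, Finset.sum_mul_sum, Finset.sum_product]
    refine Finset.sum_congr rfl fun i _ => Finset.sum_congr rfl fun j _ => ?_
    simp only [G]
    rw [smul_mul_smul_comm, hpow, pow_add, scal_mul, const_mul, mul_assoc, ← mul_assoc (const _),
      ← (scal_commute (f ^ j) (const (x ^ i))).eq]
    simp only [mul_assoc]
  have h2 : const (bracketing z) * expTrunc N (scal f * const x) =
      ∑ k ∈ Finset.range (N + 1), ∑ p ∈ Finset.HasAntidiagonal.antidiagonal k, G p := by
    rw [expTrunc, Finset.mul_sum]
    refine Finset.sum_congr rfl fun k _ => ?_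
    rw [hpow, mul_smul_comm, ← mul_assoc, ← (scal_commute (f ^ k) _).eq, mul_assoc, ← const_mul,
      ← sum_choose_bracketing_rightPow z c k]
    ext1 w
    rw [WordFun.smul_apply, scal_mul_const_apply, WordFun.sum_apply, Finset.smul_sum, Finset.smul_sum]
    refine Finset.sum_congr rfl fun p hp => ?_
    rw [Finset.HasAntidiagonal.mem_antidiagonal] at hp
    simp only [G]
    rw [WordFun.smul_apply, scal_mul_const_apply, hp, ← Nat.cast_smul_eq_nsmul ℝ, smul_smul, smul_smul,
      smul_smul]
    congr 1
    have h3 := Nat.add_choose_mul_factorial_mul_factorial p.2 p.1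
    rw [add_comm p.2, hp] at h3
    have h4 : (k.factorial : ℝ) = k.choose p.1 * p.2.factorial * p.1.factorial := by
      exact_mod_cast h3.symm
    have h5 : (k.factorial : ℝ) ≠ 0 := by positivity
    have h6 : (p.1.factorial : ℝ) ≠ 0 := by positivity
    have h7 : (p.2.factorial : ℝ) ≠ 0 := by positivity
    field_simp
    rw [h4]; ring
  -- One side sums `G` over the square i, j ≤ N, the other over the triangle i + j ≤ N. The
  -- remaining terms contain `f ^ (i + j)` with i + j > N and vanish to order `N`.
  rw [h1, h2, ← Finset.sum_biUnion]
  · refine (cong_sum_subset ?_ ?_).symm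
    · intro p hp
      simp only [Finset.mem_biUnion, Finset.mem_range, Finset.HasAntidiagonal.mem_antidiagonal] at hp
      simp only [Finset.mem_product, Finset.mem_range]
      omega
    · intro p _ hp
      simp only [Finset.mem_biUnion, Finset.mem_range, Finset.HasAntidiagonal.mem_antidiagonal, not_exists,
        not_and] at hp
      have : N ≤ p.1 + p.2 := by
        by_contra h
        exact hp (p.1 + p.2) (by omega) rfl
      exact (((hf.pow (p.1 + p.2)).scal.mul_right _).smul _).mono this
  · intro i _ j _ hij
    rw [Function.onFun, Finset.disjoint_left]
    intro p hp hp'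
    rw [Finset.HasAntidiagonal.mem_antidiagonal] at hp hp'
    exact hij (hp.symm.trans hp')

end

section

open WordFun

variable {A : Type*}

/-! ### Half shuffles and derivations -/

/-- The coefficients of an element of the word algebra, as a linear map. -/
def coeffFun : WordAlg A →ₗ[ℝ] WordFun A ℝ where
  toFun f := fun w => f.coeff (FreeMonoid.ofList w)
  map_add' _ _ := rfl
  map_smul' _ _ := rfl

theorem coeffFun_apply (f : WordAlg A) (w : List A) :
    coeffFun f w = f.coeff (FreeMonoid.ofList w) := rfl

open Classical in
theorem coeffFun_ofWord (u : FreeMonoid A) (w : List A) :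
    coeffFun (ofWord u) w = if FreeMonoid.toList u = w then 1 else 0 := by
  rw [coeffFun_apply, ofWord, MonoidAlgebra.coeff_single, Finsupp.single_apply]
  exact if_congr Iff.rfl rfl rfl

theorem coeffFun_ofWord_one : coeffFun (ofWord (1 : FreeMonoid A)) = 1 := by
  ext w
  rw [coeffFun_ofWord]
  cases w
  · simp [one_nil]
  · simp; rfl

theorem coeffFun_ofWord_cons_nil (a : A) (u : List A) :
    coeffFun (ofWord (FreeMonoid.ofList (a :: u))) [] = 0 := by
  classical
  rw [coeffFun_ofWord, if_neg (by simp)]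

open Classical in
theorem D_coeffFun_ofWord_cons (a b : A) (u : List A) :
    D b (coeffFun (ofWord (FreeMonoid.ofList (a :: u)))) =
      if a = b then coeffFun (ofWord (FreeMonoid.ofList u)) else 0 := by
  ext w
  rw [D_apply, coeffFun_ofWord]
  split_ifs with h1 h2 h2
  · rw [coeffFun_ofWord, if_pos]
    exact (List.cons.inj h1).2
  · exact absurd (List.cons.inj h1).1 h2
  · rw [coeffFun_ofWord, if_neg]
    intro h3
    exact h1 (by rw [h2, ← h3]; rfl)
  · rfl

theorem coeffFun_letter_mul_nil (a : A) (f : WordAlg A) :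
    coeffFun (ofWord (FreeMonoid.of a) * f) [] = 0 := by
  rw [coeffFun_apply, ofWord, MonoidAlgebra.coeff_single_mul_of_forall_mul_ne]
  intro d h
  have := congrArg FreeMonoid.toList h
  simp at this

open Classical in
theorem D_coeffFun_letter_mul (a b : A) (f : WordAlg A) :
    D b (coeffFun (ofWord (FreeMonoid.of a) * f)) = if a = b then coeffFun f else 0 := by
  ext w
  rw [D_apply, coeffFun_apply, ofWord]
  split_ifs with h
  · rw [MonoidAlgebra.coeff_single_mul_eq_mul_coeff (FreeMonoid.ofList w), one_mul]
    · rfl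
    · intro m _
      rw [← h, FreeMonoid.ofList_cons, mul_right_inj]
  · rw [MonoidAlgebra.coeff_single_mul_of_forall_mul_ne]
    · rfl
    intro d hd
    have := congrArg FreeMonoid.toList hd
    simp only [FreeMonoid.toList_of_mul, FreeMonoid.toList_ofList] at this
    exact h (List.cons.inj this).1

theorem halfShuffleWord_nil (v : List A) : halfShuffleWord [] v = 0 := by
  rw [halfShuffleWord]

theorem coeffFun_halfShuffleWord_nil (u v : List A) : coeffFun (halfShuffleWord u v) [] = 0 := by
  cases u with
  | nil => rw [halfShuffleWord_nil, map_zero]; rfl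
  | cons a u =>
    cases v with
    | nil => rw [halfShuffleWord, coeffFun_ofWord_cons_nil]
    | cons b v => rw [halfShuffleWord, coeffFun_letter_mul_nil]

/-- The shuffle product of two words, not both empty, is the sum of the two half shuffles. -/
theorem coeffFun_halfShuffleWord_add (u v : List A) (h : u ≠ [] ∨ v ≠ []) :
    coeffFun (halfShuffleWord u v) + coeffFun (halfShuffleWord v u) =
      coeffFun (ofWord (FreeMonoid.ofList u)) * coeffFun (ofWord (FreeMonoid.ofList v)) := by
  classical
  induction hn : u.length + v.length using Nat.strong_induction_on generalizing u v with
  | _ n ih =>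
  match u, v, hn with
  | [], [], _ => simp at h
  | [], b :: v, _ =>
    rw [halfShuffleWord_nil, halfShuffleWord, FreeMonoid.ofList_nil, coeffFun_ofWord_one, map_zero,
      zero_add, one_mul]
  | a :: u, [], _ =>
    rw [halfShuffleWord_nil, halfShuffleWord, FreeMonoid.ofList_nil, coeffFun_ofWord_one, map_zero,
      add_zero, mul_one]
  | a :: u, b :: v, hn =>
    refine ext_D ?_ fun c => ?_
    · rw [WordFun.add_apply, coeffFun_halfShuffleWord_nil, coeffFun_halfShuffleWord_nil, mul_nil,
        coeffFun_ofWord_cons_nil, zero_mul, add_zero]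
    · rw [halfShuffleWord, halfShuffleWord, D_add, D_coeffFun_letter_mul, D_coeffFun_letter_mul,
        D_mul, D_coeffFun_ofWord_cons, D_coeffFun_ofWord_cons, map_add, map_add]
      simp only [List.length_cons] at hn
      congr 1
      · split_ifs
        · exact ih _ (by simp only [List.length_cons]; omega) u (b :: v) (by simp) rfl
        · rw [zero_mul]
      · split_ifs
        · rw [add_comm]
          exact ih _ (by simp only [List.length_cons]; omega) (a :: u) v (by simp) rfl
        · rw [mul_zero]

/-- The half shuffle keeps the shuffles that begin with the first letter of `u`, so the derivation
acts on the left factor only. This is the sole property of ≺ used later, besides the vanishing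
constant term. -/
theorem D_coeffFun_halfShuffleWord (b : A) (u v : List A) :
    D b (coeffFun (halfShuffleWord u v)) =
      D b (coeffFun (ofWord (FreeMonoid.ofList u))) * coeffFun (ofWord (FreeMonoid.ofList v)) := by
  classical
  cases u with
  | nil => rw [halfShuffleWord_nil, FreeMonoid.ofList_nil, coeffFun_ofWord_one, D_one, zero_mul,
      map_zero, D_zero]
  | cons a u =>
    cases v with
    | nil => rw [halfShuffleWord, FreeMonoid.ofList_nil, coeffFun_ofWord_one, mul_one]
    | cons c v =>
      rw [halfShuffleWord, D_coeffFun_letter_mul, D_coeffFun_ofWord_cons, map_add,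
        coeffFun_halfShuffleWord_add _ _ (by simp), ite_mul, zero_mul]

theorem coeffFun_eq_sum (f : WordAlg A) :
    coeffFun f = ∑ u ∈ f.coeff.support, f.coeff u • coeffFun (ofWord u) := by
  conv_lhs => rw [← MonoidAlgebra.sum_coeff_single f, Finsupp.sum, map_sum]
  refine Finset.sum_congr rfl fun u _ => ?_
  rw [← map_smul, ofWord, MonoidAlgebra.smul_single, smul_eq_mul, mul_one]

theorem coeffFun_halfShuffle (f g : WordAlg A) :
    coeffFun (halfShuffle f g) = ∑ u ∈ f.coeff.support, ∑ v ∈ g.coeff.support,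
      (f.coeff u * g.coeff v) •
        coeffFun (halfShuffleWord (FreeMonoid.toList u) (FreeMonoid.toList v)) := by
  simp only [halfShuffle, Finsupp.sum, map_sum, map_smul]

theorem coeffFun_halfShuffle_nil (f g : WordAlg A) : coeffFun (halfShuffle f g) [] = 0 := by
  rw [coeffFun_halfShuffle, WordFun.sum_apply]
  refine Finset.sum_eq_zero fun u _ => ?_
  rw [WordFun.sum_apply]
  refine Finset.sum_eq_zero fun v _ => ?_
  rw [WordFun.smul_apply, coeffFun_halfShuffleWord_nil, smul_zero]

theorem D_coeffFun_halfShuffle (b : A) (f g : WordAlg A) :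
    D b (coeffFun (halfShuffle f g)) = D b (coeffFun f) * coeffFun g := by
  rw [coeffFun_halfShuffle, coeffFun_eq_sum f, coeffFun_eq_sum g, D_sum, D_sum, Finset.sum_mul_sum]
  refine Finset.sum_congr rfl fun u _ => ?_
  rw [D_sum]
  refine Finset.sum_congr rfl fun v _ => ?_
  rw [D_smul, D_smul, D_coeffFun_halfShuffleWord, smul_mul_smul_comm]
  rfl

/-! ### The dual elements attached to trees -/

/-- The element `S_t` attached to a tree `t` by `S_a = a` and `S_{(s, t)} = α (S_s ≺ S_t)`. -/
def dualTree : FreeMagma A → WordAlg A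
  | .of a => ofWord (FreeMonoid.of a)
  | .mul s t => (lazardDepth (s * t) : ℝ) • halfShuffle (dualTree s) (dualTree t)

/-- The coefficient function of `dualTree t`. -/
def dualFun (t : FreeMagma A) : WordFun A ℝ := coeffFun (dualTree t)

theorem dualTree_mul (s t : FreeMagma A) :
    dualTree (s * t) = (lazardDepth (s * t) : ℝ) • halfShuffle (dualTree s) (dualTree t) := rfl

theorem dualFun_nil (t : FreeMagma A) : dualFun t [] = 0 := by
  cases t with
  | of a => exact coeffFun_ofWord_cons_nil a []
  | mul s t =>
    rw [dualFun, dualTree, map_smul, WordFun.smul_apply, coeffFun_halfShuffle_nil, smul_zero]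

theorem D_dualFun_mul (a : A) (s t : FreeMagma A) :
    D a (dualFun (s * t)) = (lazardDepth (s * t) : ℝ) • (D a (dualFun s) * dualFun t) := by
  rw [dualFun, dualTree_mul, map_smul, D_smul, D_coeffFun_halfShuffle]
  rfl

open Classical in
theorem D_dualFun_of (a b : A) :
    D b (dualFun (FreeMagma.of a)) = if a = b then (1 : WordFun A ℝ) else 0 := by
  have := D_coeffFun_ofWord_cons a b []
  rw [FreeMonoid.ofList_nil, coeffFun_ofWord_one] at this
  exact this

theorem vanish_dualFun (t : FreeMagma A) : Vanish 1 (dualFun t) := by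
  intro w hw
  rw [List.length_eq_zero_iff.1 (by omega : w.length = 0), dualFun_nil]

/-- Each further factor `c` contributes one `dualFun c` and the Lazard depth 1/j at step j; the
depths multiply to 1/k!, as required by the exponential series. -/
theorem D_dualFun_rightPow (a : A) (z c : FreeMagma A) (hz : ∀ x, z ≠ x * c) (k : ℕ) :
    D a (dualFun (rightPow z c k)) =
      ((k.factorial : ℝ)⁻¹) • (D a (dualFun z) * dualFun c ^ k) := by
  induction k with
  | zero => simp [rightPow]
  | succ k ih =>
    rw [rightPow, D_dualFun_mul, ih, ← rightPow, lazardDepth,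
      lazardExponent_rightPow z c hz (k + 1) k.succ_pos, smul_mul_assoc, smul_smul, mul_assoc,
      ← pow_succ, Nat.factorial_succ]
    push_cast
    rw [mul_inv, one_div]

/-! ### Homogeneity of the dual elements -/

/-- `f` is supported on words of length `n`. -/
def WordFun.Homogeneous {R : Type*} [Ring R] (n : ℕ) (f : WordFun A R) : Prop :=
  ∀ w, w.length ≠ n → f w = 0

theorem WordFun.Homogeneous.mul {R : Type*} [Ring R] [Algebra ℝ R] {m n : ℕ} {f g : WordFun A R}
    (hf : Homogeneous m f) (hg : Homogeneous n g) : Homogeneous (m + n) (f * g) := by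
  have hD : ∀ {p : ℕ} {k : WordFun A R} (a : A), Homogeneous (p + 1) k → Homogeneous p (D a k) :=
    fun a hk v hv => hk (a :: v) (by simpa using hv)
  have hD0 : ∀ {k : WordFun A R} (a : A), Homogeneous 0 k → D a k = 0 :=
    fun a hk => ext fun v => hk (a :: v) (by simp)
  intro w
  induction w generalizing f g m n with
  | nil =>
    intro h
    rw [mul_nil]
    rcases Nat.eq_zero_or_pos m with rfl | hm
    · rw [hg [] (by simpa using h), mul_zero]
    · rw [hf [] (by simpa using hm.ne), zero_mul]
  | cons a w ih =>
    intro h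
    rw [mul_cons]
    simp only [List.length_cons] at h
    have h1 : (D a f * g) w = 0 := by
      cases m with
      | zero => rw [hD0 a hf, zero_mul, WordFun.zero_apply]
      | succ m => exact ih (hD a hf) hg (by omega)
    have h2 : (f * D a g) w = 0 := by
      cases n with
      | zero => rw [hD0 a hg, mul_zero, WordFun.zero_apply]
      | succ n => exact ih hf (hD a hg) (by omega)
    rw [h1, h2, add_zero]

theorem homogeneous_dualFun (t : FreeMagma A) : Homogeneous t.length (dualFun t) := by
  classical
  induction t using FreeMagma.recOnMul with
  | ih1 a =>
    intro w hw
    refine (coeffFun_ofWord _ _).trans (if_neg ?_)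
    rintro rfl
    exact hw rfl
  | ih2 s t hs ht =>
    intro w hw
    cases w with
    | nil => exact dualFun_nil _
    | cons a w =>
      change D a (dualFun (s * t)) w = 0
      rw [D_dualFun_mul, WordFun.smul_apply]
      obtain ⟨m, hm⟩ : ∃ m, s.length = m + 1 := ⟨s.length - 1, by have := s.length_pos; omega⟩
      have h1 : Homogeneous m (D a (dualFun s)) := fun v hv => hs (a :: v) (by simpa [hm] using hv)
      rw [h1.mul ht w ?_, smul_zero]
      have : (s * t).length = s.length + t.length := rfl
      simp only [List.length_cons] at hw
      omega

end

section

open WordFun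

variable {A : Type*}

/-! ### Lazard elimination in a Hall set -/

theorem tree_mul_inj {s t s' t' : FreeMagma A} (h : s * t = s' * t') : s = s' ∧ t = t' := by
  cases h
  exact ⟨rfl, rfl⟩

theorem length_mul (s t : FreeMagma A) : (s * t).length = s.length + t.length := rfl

theorem mul_right_ne (s t : FreeMagma A) : s * t ≠ t := by
  intro h
  have h1 := congrArg FreeMagma.length h
  rw [length_mul] at h1
  have := s.length_pos
  omega

theorem finite_setOf_length_le [Finite A] (N : ℕ) : {t : FreeMagma A | t.length ≤ N}.Finite := by
  induction N with
  | zero =>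
    convert Set.finite_empty
    ext t
    have := t.length_pos
    simp only [Set.mem_ofPred_eq, Set.mem_empty_iff_false, iff_false]
    omega
  | succ N ih =>
    refine ((Set.finite_range FreeMagma.of).union (Set.Finite.image2 (· * ·) ih ih)).subset ?_
    intro t ht
    rw [Set.mem_ofPred_eq] at ht
    cases t with
    | of a => exact Or.inl ⟨a, rfl⟩
    | mul s t =>
      have h : s.length + t.length ≤ N + 1 := ht
      have := s.length_pos
      have := t.length_pos
      exact Or.inr ⟨s, by simp only [Set.mem_ofPred_eq]; omega, t,
        by simp only [Set.mem_ofPred_eq]; omega, rfl⟩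

theorem length_rightPow (z c : FreeMagma A) (k : ℕ) :
    (rightPow z c k).length = z.length + k * c.length := by
  induction k with
  | zero => simp [rightPow]
  | succ k ih => rw [rightPow, length_mul, ih, Nat.succ_mul, add_assoc]

theorem rightPow_inj {z z' c : FreeMagma A} (hz : ∀ x, z ≠ x * c) (hz' : ∀ x, z' ≠ x * c)
    {k k' : ℕ} (h : rightPow z c k = rightPow z' c k') : z = z' ∧ k = k' := by
  have hk : k = k' := by
    rw [← rightMultiplicity_rightPow z c hz k, h, rightMultiplicity_rightPow z' c hz' k']
  subst hk
  refine ⟨?_, rfl⟩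
  induction k with
  | zero => exact h
  | succ k ih => exact ih (tree_mul_inj h).1

section Elimination

variable {H : Set (FreeMagma A)} {lt : FreeMagma A → FreeMagma A → Prop}

/-- A decreasing enumeration of a lower set of the Hall trees of degree at most `N`. -/
structure IsLowerList (H : Set (FreeMagma A)) (lt : FreeMagma A → FreeMagma A → Prop) (N : ℕ)
    (r : List (FreeMagma A)) : Prop where
  sorted : r.Pairwise fun s t => lt t s
  sub : ∀ t ∈ r, t ∈ H ∧ t.length ≤ N
  lower : ∀ s ∈ H, s.length ≤ N → ∀ t ∈ r, lt s t → s ∈ r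

/-- `t` is not of the form `(x, y)` with `y` in `r`. -/
def Primitive (r : List (FreeMagma A)) (t : FreeMagma A) : Prop := ∀ x y, t = x * y → y ∉ r

theorem IsHallSet.asymm (hH : IsHallSet H lt) {s t : FreeMagma A} (hs : s ∈ H) (ht : t ∈ H)
    (h : lt s t) : ¬ lt t s :=
  fun h' => hH.irrefl s hs (hH.trans s hs t ht s hs h h')

theorem IsHallSet.of_mul (hH : IsHallSet H lt) {s t : FreeMagma A} (h : s * t ∈ H) :
    s ∈ H ∧ t ∈ H ∧ lt s t ∧ lt (s * t) t :=
  have h' := (hH.mul_mem_iff s t).1 h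
  ⟨h'.1, h'.2.1, h'.2.2.1, hH.ancestral s t h h'.2.1⟩

theorem exists_decreasing_enumeration (hH : IsHallSet H lt) (s : Set (FreeMagma A)) (hs : s.Finite)
    (hsH : s ⊆ H) : ∃ l : List (FreeMagma A), (l.Pairwise fun s t => lt t s) ∧ ∀ t, t ∈ l ↔ t ∈ s := by
  classical
  induction hn : hs.toFinset.card generalizing s with
  | zero =>
    refine ⟨[], List.Pairwise.nil, fun t => ?_⟩
    rw [Finset.card_eq_zero, Set.Finite.toFinset_eq_empty] at hn
    simp [hn]
  | succ n ih =>
    have hne : s.Nonempty := by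
      rw [Set.nonempty_iff_ne_empty]
      rintro rfl
      simp at hn
    obtain ⟨c, hc, hmax⟩ : ∃ c ∈ s, ∀ t ∈ s, ¬ lt c t := by
      have hwf : s.WellFoundedOn fun a b => lt b a := by
        have : IsStrictOrder s fun a b => lt b.1 a.1 :=
          { irrefl := fun a => hH.irrefl a.1 (hsH a.2)
            trans := fun a b c hab hbc =>
              hH.trans c.1 (hsH c.2) b.1 (hsH b.2) a.1 (hsH a.2) hbc hab }
        have : Finite s := hs
        exact Finite.wellFounded_of_trans_of_irrefl fun a b : s => lt b.1 a.1
      obtain ⟨c, -, hc⟩ := WellFounded.has_min hwf Set.univ ⟨⟨hne.some, hne.some_mem⟩, trivial⟩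
      exact ⟨c.1, c.2, fun t ht h => hc ⟨t, ht⟩ trivial h⟩
    obtain ⟨l, hl, hmem⟩ := ih (s \ {c}) (hs.subset Set.sdiff_subset)
      (Set.sdiff_subset.trans hsH) (by
        have : (hs.subset (Set.sdiff_subset : s \ {c} ⊆ s)).toFinset = hs.toFinset.erase c := by
          ext; simp [and_comm]
        rw [this, Finset.card_erase_of_mem (by simpa using hc), hn]; rfl)
    refine ⟨c :: l, List.pairwise_cons.2 ⟨fun t ht => ?_, hl⟩, fun t => ?_⟩
    · obtain ⟨hts, htc⟩ := (hmem t).1 ht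
      rcases hH.total t (hsH hts) c (hsH hc) with h | h | h
      · exact h
      · exact absurd h htc
      · exact absurd h (hmax t hts)
    · rw [List.mem_cons, hmem]
      by_cases h : t = c
      · simp [h, hc]
      · simp [h]

variable {N : ℕ} {c : FreeMagma A} {r : List (FreeMagma A)}

namespace IsLowerList

theorem head_mem (h : IsLowerList H lt N (c :: r)) : c ∈ H := (h.sub c (by simp)).1

theorem lt_head (h : IsLowerList H lt N (c :: r)) {t : FreeMagma A} (ht : t ∈ r) : lt t c :=
  (List.pairwise_cons.1 h.sorted).1 t ht

theorem head_notMem (hH : IsHallSet H lt) (h : IsLowerList H lt N (c :: r)) : c ∉ r :=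
  fun hc => hH.irrefl c h.head_mem (h.lt_head hc)

theorem mem_tail (hH : IsHallSet H lt) (h : IsLowerList H lt N (c :: r)) {s : FreeMagma A}
    (hs : s ∈ H) (hsN : s.length ≤ N) (hsc : lt s c) : s ∈ r := by
  rcases List.mem_cons.1 (h.lower s hs hsN c (by simp) hsc) with rfl | h'
  · exact absurd hsc (hH.irrefl s hs)
  · exact h'

theorem tail (hH : IsHallSet H lt) (h : IsLowerList H lt N (c :: r)) : IsLowerList H lt N r where
  sorted := (List.pairwise_cons.1 h.sorted).2
  sub t ht := h.sub t (by simp [ht])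
  lower s hs hsN t ht hst := h.mem_tail hH hs hsN
    (hH.trans s hs t (h.sub t (by simp [ht])).1 c h.head_mem hst (h.lt_head ht))

/-- A Hall tree is smaller than its right child, whereas `c` is the largest tree of the list. -/
theorem primitive_head (hH : IsHallSet H lt) (h : IsLowerList H lt N (c :: r)) :
    Primitive (c :: r) c := by
  intro x y hxy hy
  have h1 := hH.of_mul (hxy ▸ h.head_mem)
  rcases List.mem_cons.1 hy with rfl | hy
  · exact mul_right_ne x y hxy.symm
  · exact hH.asymm h1.2.1 h.head_mem (h.lt_head hy) (hxy ▸ h1.2.2.2)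

/-- A right child below `c` would lie in the lower set `r`. The conclusion is precisely the Hall
condition for multiplying `x * y` by `c` on the right. -/
theorem le_right_of_primitive (hH : IsHallSet H lt) (h : IsLowerList H lt N (c :: r))
    {x y : FreeMagma A} (hm : x * y ∈ H) (hN : (x * y).length ≤ N) (hp : Primitive r (x * y)) :
    lt c y ∨ c = y := by
  have hy := (hH.of_mul hm).2.1
  rcases hH.total y hy c h.head_mem with h1 | h1 | h1
  · exact absurd (h.mem_tail hH hy (by rw [length_mul] at hN; omega) h1) (hp x y rfl)
  · exact Or.inr h1.symm
  · exact Or.inl h1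

/-- The Hall condition on `x * c` makes the right child of `x` at least `c`, while all of `r` lies
below `c`. This is the inverse of `mul_head_mem`. -/
theorem primitive_left (hH : IsHallSet H lt) (h : IsLowerList H lt N (c :: r)) {x : FreeMagma A}
    (hx : x * c ∈ r) : x ∈ r ∧ Primitive r x := by
  obtain ⟨hm, hN⟩ := h.sub (x * c) (by simp [hx])
  have h1 := hH.of_mul hm
  rw [length_mul] at hN
  refine ⟨h.mem_tail hH h1.1 (by omega) h1.2.2.1, ?_⟩
  rintro u v rfl hv
  rcases ((hH.mul_mem_iff _ _).1 hm).2.2.2 with ⟨a, ha⟩ | ⟨s', s'', hs, hle⟩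
  · cases ha
  · obtain ⟨rfl, rfl⟩ := tree_mul_inj hs
    rcases hle with hle | rfl
    · exact hH.asymm h1.2.1 (hH.of_mul h1.1).2.1 hle (h.lt_head hv)
    · exact h.head_notMem hH hv

theorem mul_head_mem (hH : IsHallSet H lt) (h : IsLowerList H lt N (c :: r)) {x : FreeMagma A}
    (hx : x ∈ r) (hp : Primitive r x) (hN : (x * c).length ≤ N) :
    x * c ∈ r ∧ Primitive r (x * c) := by
  obtain ⟨hxH, hxN⟩ := h.sub x (by simp [hx])
  have hm : x * c ∈ H := by
    refine (hH.mul_mem_iff _ _).2 ⟨hxH, h.head_mem, h.lt_head hx, ?_⟩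
    cases x with
    | of a => exact Or.inl ⟨a, rfl⟩
    | mul u v => exact Or.inr ⟨u, v, rfl, h.le_right_of_primitive hH hxH hxN hp⟩
  refine ⟨h.mem_tail hH hm hN (hH.of_mul hm).2.2.2, fun u v huv hv => ?_⟩
  obtain ⟨rfl, rfl⟩ := tree_mul_inj huv
  exact h.head_notMem hH hv

end IsLowerList

theorem Primitive.of_cons {t : FreeMagma A} (h : Primitive (c :: r) t) : Primitive r t :=
  fun x y hxy hy => h x y hxy (by simp [hy])

theorem Primitive.ne_mul {t : FreeMagma A} (h : Primitive (c :: r) t) (x : FreeMagma A) :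
    t ≠ x * c :=
  fun hx => h x c hx (by simp)

theorem Primitive.cons {t : FreeMagma A} (h : Primitive r t) (hc : ∀ x, t ≠ x * c) :
    Primitive (c :: r) t := by
  intro x y hxy hy
  rcases List.mem_cons.1 hy with rfl | hy
  · exact hc x hxy
  · exact h x y hxy hy

namespace IsLowerList

theorem rightPow_mem (hH : IsHallSet H lt) (h : IsLowerList H lt N (c :: r)) {z : FreeMagma A}
    (hz : z ∈ r) (hp : Primitive (c :: r) z) (k : ℕ) (hN : (rightPow z c k).length ≤ N) :
    rightPow z c k ∈ r ∧ Primitive r (rightPow z c k) := by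
  induction k with
  | zero => exact ⟨hz, hp.of_cons⟩
  | succ k ih =>
    have hN' : (rightPow z c k * c).length ≤ N := hN
    obtain ⟨h1, h2⟩ := ih (by rw [length_mul] at hN'; omega)
    exact h.mul_head_mem hH h1 h2 hN'

/-- Stripping right factors `c` preserves membership in `r` and primitivity, and ends at a tree with
another right child or at a letter. With `rightPow_mem` and `rightPow_inj` this is Lazard
elimination: up to degree `N`, the primitive trees of `r` are the (z c^k), each obtained once. -/
theorem exists_rightPow (hH : IsHallSet H lt) (h : IsLowerList H lt N (c :: r)) {t : FreeMagma A}
    (ht : t ∈ r) (hp : Primitive r t) :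
    ∃ z k, z ∈ r ∧ Primitive (c :: r) z ∧ t = rightPow z c k := by
  induction t using FreeMagma.recOnMul with
  | ih1 a => exact ⟨FreeMagma.of a, 0, ht, fun x y hxy => (by cases hxy), rfl⟩
  | ih2 x y ihx _ =>
    by_cases hy : y = c
    · subst hy
      obtain ⟨h1, h2⟩ := h.primitive_left hH ht
      obtain ⟨z, k, hz, hzp, rfl⟩ := ihx h1 h2
      exact ⟨z, k + 1, hz, hzp, rfl⟩
    · exact ⟨_, 0, ht, hp.cons fun u hu => hy (tree_mul_inj hu).2, rfl⟩

end IsLowerList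

/-! ### The factorization of the generating series of words -/

/-- The term of the logarithmic derivative attached to a tree. -/
def logTerm (a : A) (t : FreeMagma A) : WordFun A (WordAlg A) :=
  scal (D a (dualFun t)) * const (bracketing t)

theorem vanish_logTerm (a : A) {t : FreeMagma A} (h : N < t.length) : Vanish N (logTerm a t) := by
  refine Vanish.mul_right (Vanish.scal fun w hw => ?_) _
  exact homogeneous_dualFun t (a :: w) (by simp only [List.length_cons]; omega)

open Classical in
/-- The logarithmic derivative of the partial product of exponentials over `r`. -/
def logDeriv (r : List (FreeMagma A)) (a : A) : WordFun A (WordAlg A) :=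
  ∑ t ∈ r.toFinset with Primitive r t, logTerm a t

/-- The truncated exponential of `S_t ⊗ [t]`. -/
def treeExp (N : ℕ) (t : FreeMagma A) : WordFun A (WordAlg A) :=
  expTrunc N (scal (dualFun t) * const (bracketing t))

/-- The product of the exponentials of `S_t ⊗ [t]` over a list of trees. -/
def treeExpProd (N : ℕ) (r : List (FreeMagma A)) : WordFun A (WordAlg A) :=
  (r.map (treeExp N)).prod

open Classical in
theorem logDeriv_cons (hH : IsHallSet H lt) (h : IsLowerList H lt N (c :: r)) (a : A) :
    logDeriv (c :: r) a =
      logTerm a c + ∑ t ∈ r.toFinset with Primitive (c :: r) t, logTerm a t := by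
  rw [logDeriv, List.toFinset_cons, Finset.filter_insert, if_pos (h.primitive_head hH),
    Finset.sum_insert]
  simp [h.head_notMem hH]

-- Lazard elimination reindexes the sum by pairs (z, k). The bound k ≤ N loses nothing, since (z
-- c^k) has degree at least k; pairs giving degree above `N` contribute terms of order `N`.
open Classical in
theorem logDeriv_tail (hH : IsHallSet H lt) (h : IsLowerList H lt N (c :: r)) (a : A) :
    Cong N (logDeriv r a)
      (∑ z ∈ r.toFinset with Primitive (c :: r) z, ∑ k ∈ Finset.range (N + 1),
        logTerm a (rightPow z c k)) := by
  have hinj : Set.InjOn (fun p : FreeMagma A × ℕ => rightPow p.1 c p.2)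
      (({z ∈ r.toFinset | Primitive (c :: r) z} ×ˢ Finset.range (N + 1) :
        Finset (FreeMagma A × ℕ)) : Set (FreeMagma A × ℕ)) := by
    rintro ⟨z, k⟩ hp ⟨z', k'⟩ hp' heq
    simp only [Finset.coe_product, Set.mem_prod, Finset.coe_filter, Set.mem_ofPred_eq] at hp hp'
    obtain ⟨rfl, rfl⟩ := rightPow_inj hp.1.2.ne_mul hp'.1.2.ne_mul heq
    rfl
  rw [← Finset.sum_product', ← Finset.sum_image (f := logTerm a) hinj, logDeriv]
  refine cong_sum_subset ?_ ?_
  · intro t ht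
    simp only [Finset.mem_filter, List.mem_toFinset] at ht
    obtain ⟨z, k, hz, hzp, rfl⟩ := h.exists_rightPow hH ht.1 ht.2
    have hN := (h.sub _ (List.mem_cons_of_mem c ht.1)).2
    rw [length_rightPow] at hN
    have : k ≤ k * c.length := Nat.le_mul_of_pos_right k c.length_pos
    exact Finset.mem_image.2 ⟨(z, k), by simp [hz, hzp]; omega, rfl⟩
  · intro t ht ht'
    obtain ⟨⟨z, k⟩, hzk, rfl⟩ := Finset.mem_image.1 ht
    simp only [Finset.mem_product, Finset.mem_filter, List.mem_toFinset] at hzk ht'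
    refine vanish_logTerm a ?_
    by_contra hN
    exact ht' (h.rightPow_mem hH hzk.1.1 hzk.1.2 k (not_lt.1 hN))

-- For fixed z, the terms of the trees (z c^k) share the central factor `D a (dualFun z)`. What is
-- left is an exponential series in ad [c], that is, [z] conjugated by `treeExp N c`.
open Classical in
theorem treeExp_mul_logDeriv (hH : IsHallSet H lt) (h : IsLowerList H lt N (c :: r)) (a : A) :
    Cong N (treeExp N c * logDeriv r a)
      ((∑ z ∈ r.toFinset with Primitive (c :: r) z, logTerm a z) * treeExp N c) := by
  refine (Cong.mul (Cong.refl N _) (logDeriv_tail hH h a)).trans ?_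
  rw [Finset.mul_sum, Finset.sum_mul]
  refine Cong.sum fun z hz => ?_
  simp only [Finset.mem_filter] at hz
  have h1 : ∑ k ∈ Finset.range (N + 1), logTerm a (rightPow z c k) =
      scal (D a (dualFun z)) * ∑ k ∈ Finset.range (N + 1), ((k.factorial : ℝ)⁻¹) •
        (scal (dualFun c ^ k) * const (bracketing (rightPow z c k))) := by
    rw [Finset.mul_sum]
    refine Finset.sum_congr rfl fun k _ => ?_
    rw [logTerm, D_dualFun_rightPow a z c hz.2.ne_mul, scal_smul, scal_mul, smul_mul_assoc,
      mul_smul_comm, mul_assoc]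
  rw [h1, ← mul_assoc, ← (scal_commute _ (treeExp N c)).eq, mul_assoc, logTerm, mul_assoc]
  exact (Cong.refl N _).mul (expTrunc_mul_sum_rightPow N z c (vanish_dualFun c))

/-- The exponent commutes with its derivative: both are scalar functions times the same bracket. -/
theorem D_treeExp (a : A) (c : FreeMagma A) :
    Cong N (D a (treeExp N c)) (logTerm a c * treeExp N c) := by
  have hD : D a (scal (dualFun c) * const (bracketing c)) = logTerm a c := by
    rw [D_mul, D_const, mul_zero, add_zero]; rfl
  have hc : Commute (D a (scal (dualFun c) * const (bracketing c)))
      (scal (dualFun c) * const (bracketing c) : WordFun A (WordAlg A)) := by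
    rw [hD, logTerm]
    exact ((scal_commute _ _).mul_left
      ((scal_commute _ _).symm.mul_right (Commute.refl _)))
  have := D_expTrunc N a hc ((vanish_dualFun c).scal.mul_right _)
  rwa [hD] at this

theorem D_treeExpProd (hH : IsHallSet H lt) (h : IsLowerList H lt N r) (a : A) :
    Cong N (D a (treeExpProd N r)) (logDeriv r a * treeExpProd N r) := by
  classical
  induction r with
  | nil =>
    have h1 : treeExpProd N ([] : List (FreeMagma A)) = 1 := rfl
    have h2 : logDeriv ([] : List (FreeMagma A)) a = 0 := by simp [logDeriv]
    rw [h1, h2, D_one, zero_mul]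
    exact Cong.refl N _
  | cons c r ih =>
    have h1 : treeExpProd N (c :: r) = treeExp N c * treeExpProd N r := by
      simp [treeExpProd]
    rw [h1, D_mul, logDeriv_cons hH h, add_mul]
    refine Cong.add ?_ ?_
    · rw [← mul_assoc]
      exact (D_treeExp a c).mul (Cong.refl N _)
    -- The logarithmic derivative of the tail is carried past the new exponential, which replaces it
    -- by its conjugate.
    · refine ((Cong.refl N _).mul (ih (h.tail hH))).trans ?_
      rw [← mul_assoc, ← mul_assoc]
      exact (treeExp_mul_logDeriv hH h a).mul (Cong.refl N _)

theorem treeExpProd_nil (r : List (FreeMagma A)) : treeExpProd N r [] = 1 := by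
  induction r with
  | nil => rfl
  | cons c r ih =>
    have h1 : treeExpProd N (c :: r) = treeExp N c * treeExpProd N r := by
      simp [treeExpProd]
    rw [h1, mul_nil, ih, mul_one]
    exact expTrunc_nil N ((vanish_dualFun c).scal.mul_right _)

/-- A decreasing enumeration of all Hall trees of degree at most `N`. -/
structure IsHallList (H : Set (FreeMagma A)) (lt : FreeMagma A → FreeMagma A → Prop) (N : ℕ)
    (r : List (FreeMagma A)) : Prop where
  sorted : r.Pairwise fun s t => lt t s
  mem_iff : ∀ t, t ∈ r ↔ t ∈ H ∧ t.length ≤ N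

theorem exists_isHallList [Finite A] (hH : IsHallSet H lt) (N : ℕ) :
    ∃ r, IsHallList H lt N r := by
  obtain ⟨l, h1, h2⟩ := exists_decreasing_enumeration hH (H ∩ {t | t.length ≤ N})
    ((finite_setOf_length_le N).subset Set.inter_subset_right) Set.inter_subset_left
  exact ⟨l, h1, h2⟩

theorem IsHallList.isLowerList (h : IsHallList H lt N r) : IsLowerList H lt N r where
  sorted := h.sorted
  sub t ht := (h.mem_iff t).1 ht
  lower s hs hsN _ _ _ := (h.mem_iff s).2 ⟨hs, hsN⟩

theorem IsHallList.primitive_iff (hH : IsHallSet H lt) (h : IsHallList H lt N r)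
    {t : FreeMagma A} (ht : t ∈ r) : Primitive r t ↔ ∃ a, t = FreeMagma.of a := by
  constructor
  · intro hp
    cases t with
    | of a => exact ⟨a, rfl⟩
    | mul x y =>
      obtain ⟨hm, hN⟩ := (h.mem_iff _).1 ht
      have hN' : x.length + y.length ≤ N := hN
      exact absurd ((h.mem_iff y).2 ⟨(hH.of_mul hm).2.1, by omega⟩) (hp x y rfl)
  · rintro ⟨a, rfl⟩ x y hxy
    cases hxy

theorem IsHallList.logDeriv_eq (hH : IsHallSet H lt) (h : IsHallList H lt N r) (hN : 0 < N)
    (a : A) : logDeriv r a = const (ofWord (FreeMonoid.of a)) := by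
  classical
  have hmem : ∀ b, FreeMagma.of b ∈ r := fun b => (h.mem_iff _).2 ⟨hH.letter_mem b, hN⟩
  rw [logDeriv, Finset.sum_eq_single (FreeMagma.of a)]
  · rw [logTerm, D_dualFun_of, if_pos rfl, scal_one, one_mul]; rfl
  · intro t ht hta
    simp only [Finset.mem_filter, List.mem_toFinset] at ht
    obtain ⟨b, rfl⟩ := (h.primitive_iff hH ht.1).1 ht.2
    rw [logTerm, D_dualFun_of, if_neg (by rintro rfl; exact hta rfl)]
    have : (scal 0 : WordFun A (WordAlg A)) = 0 := ext fun w => map_zero _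
    rw [this, zero_mul]
  · intro ha
    exact absurd (by simp [hmem, (h.primitive_iff hH (hmem a)).2 ⟨a, rfl⟩]) ha

/-- The product of exponentials over the Hall trees is the generating series of words. -/
theorem IsHallList.treeExpProd_apply (hH : IsHallSet H lt) (h : IsHallList H lt N r)
    (w : List A) (hw : w.length ≤ N) :
    treeExpProd N r w = ofWord (FreeMonoid.ofList w) := by
  induction w with
  | nil => rw [treeExpProd_nil]; rfl
  | cons a w ih =>
    simp only [List.length_cons] at hw
    have := D_treeExpProd hH h.isLowerList a w (by omega)
    rw [h.logDeriv_eq hH (by omega), const_mul_apply, ih (by omega), D_apply] at this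
    rw [this, ofWord, ofWord, MonoidAlgebra.single_mul_single, one_mul]
    rfl

end Elimination

end

section

open WordFun

variable {A : Type*}

/-! ### Uniqueness of the factorization into Hall words -/

theorem length_foliage (t : FreeMagma A) : (foliage t).length = t.length := by
  induction t using FreeMagma.recOnMul with
  | ih1 a => rfl
  | ih2 s t hs ht =>
    rw [foliage, map_mul, FreeMonoid.length_mul, length_mul, ← hs, ← ht]; rfl

theorem foliageProd_cons (t : FreeMagma A) (l : List (FreeMagma A)) :
    foliageProd (t :: l) = foliage t * foliageProd l := by
  simp [foliageProd]

theorem foliageProd_append (l l' : List (FreeMagma A)) :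
    foliageProd (l ++ l') = foliageProd l * foliageProd l' := by
  simp [foliageProd]

theorem length_le_of_mem {t : FreeMagma A} {l : List (FreeMagma A)} (h : t ∈ l) :
    t.length ≤ (foliageProd l).length := by
  induction l with
  | nil => simp at h
  | cons s l ih =>
    rw [foliageProd_cons, FreeMonoid.length_mul]
    rcases List.mem_cons.1 h with rfl | h
    · rw [length_foliage]; omega
    · have := ih h; omega

open Classical in
/-- Undo the right multiplications by `c` in a tree. -/
def expand (c : FreeMagma A) : FreeMagma A → List (FreeMagma A)
  | .of a => [.of a]
  | .mul x y => if y = c then expand c x ++ [c] else [x * y]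

theorem expand_mul_self (c x : FreeMagma A) : expand c (x * c) = expand c x ++ [c] :=
  if_pos rfl

theorem expand_of_ne (c t : FreeMagma A) (h : ∀ x, t ≠ x * c) : expand c t = [t] := by
  cases t with
  | of a => rfl
  | mul x y => exact if_neg fun hy => h x (by rw [hy]; rfl)

theorem foliageProd_expand (c t : FreeMagma A) : foliageProd (expand c t) = foliage t := by
  induction t using FreeMagma.recOnMul with
  | ih1 a => exact mul_one _
  | ih2 x y ihx _ =>
    by_cases hy : y = c
    · subst hy
      rw [expand_mul_self, foliageProd_append, ihx, foliage, map_mul]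
      exact congrArg _ (mul_one _)
    · rw [expand_of_ne _ _ fun u hu => hy (tree_mul_inj hu).2]
      exact mul_one _

theorem foliageProd_flatMap_expand (c : FreeMagma A) (l : List (FreeMagma A)) :
    foliageProd (l.flatMap (expand c)) = foliageProd l := by
  induction l with
  | nil => rfl
  | cons t l ih => rw [List.flatMap_cons, foliageProd_append, foliageProd_expand, ih,
      foliageProd_cons]

open Classical in
/-- Scan a list of trees, with current tree `t`, multiplying trees smaller than `c` by the
occurrences of `c` that follow them. -/
def collapseFrom (lt : FreeMagma A → FreeMagma A → Prop) (c : FreeMagma A) :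
    FreeMagma A → List (FreeMagma A) → List (FreeMagma A)
  | t, [] => [t]
  | t, x :: l => if x = c ∧ lt t c then collapseFrom lt c (t * c) l else t :: collapseFrom lt c x l

/-- Multiply the trees smaller than `c` in a list by the occurrences of `c` that follow them. -/
def collapse (lt : FreeMagma A → FreeMagma A → Prop) (c : FreeMagma A) :
    List (FreeMagma A) → List (FreeMagma A)
  | [] => []
  | t :: l => collapseFrom lt c t l

variable {H : Set (FreeMagma A)} {lt : FreeMagma A → FreeMagma A → Prop}

theorem collapse_expand_append (hH : IsHallSet H lt) (c : FreeMagma A) {t : FreeMagma A}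
    (ht : t ∈ H) (l : List (FreeMagma A)) :
    collapse lt c (expand c t ++ l) = collapseFrom lt c t l := by
  induction t using FreeMagma.recOnMul generalizing l with
  | ih1 a => rfl
  | ih2 x y ihx _ =>
    by_cases hy : y = c
    · subst hy
      have h := hH.of_mul ht
      rw [expand_mul_self, List.append_assoc, ihx h.1, List.singleton_append, collapseFrom,
        if_pos ⟨rfl, h.2.2.1⟩]
    · rw [expand_of_ne _ _ fun u hu => hy (tree_mul_inj hu).2]
      rfl

theorem expand_eq_cons (hH : IsHallSet H lt) (c : FreeMagma A) {t : FreeMagma A} (ht : t ∈ H)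
    (htc : t ≠ c) : ∃ y l, expand c t = y :: l ∧ y ≠ c := by
  induction t using FreeMagma.recOnMul with
  | ih1 a => exact ⟨_, _, rfl, htc⟩
  | ih2 x y ihx _ =>
    by_cases hy : y = c
    · subst hy
      have h := hH.of_mul ht
      obtain ⟨z, l, h1, h2⟩ := ihx h.1 (by rintro rfl; exact hH.irrefl x h.1 h.2.2.1)
      exact ⟨z, l ++ [y], by rw [expand_mul_self, h1]; rfl, h2⟩
    · exact ⟨_, _, expand_of_ne _ _ fun u hu => hy (tree_mul_inj hu).2, htc⟩

/-- The scan rebuilds each tree from its expansion, since the intermediate left factors are all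
below `c`. The pairwise condition keeps it from absorbing a `c` that was a separate entry. -/
theorem collapse_flatMap_expand (hH : IsHallSet H lt) (c : FreeMagma A) {l : List (FreeMagma A)}
    (hl : ∀ t ∈ l, t ∈ H) (hp : l.Pairwise fun t x => x = c → ¬ lt t c) :
    collapse lt c (l.flatMap (expand c)) = l := by
  induction l with
  | nil => rfl
  | cons t l ih =>
    rw [List.flatMap_cons, collapse_expand_append hH c (hl t (by simp))]
    rw [List.pairwise_cons] at hp
    have ih' := ih (fun s hs => hl s (by simp [hs])) hp.2
    cases l with
    | nil => rfl
    | cons x l =>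
      -- The scan must stop after `t`: the expansion of the next tree starts with something other
      -- than `c`, unless that tree is `c` itself, and then `t` is not below `c`.
      obtain ⟨y, ys, hy, hyc⟩ : ∃ y ys, (x :: l).flatMap (expand c) = y :: ys ∧
          ¬ (y = c ∧ lt t c) := by
        rw [List.flatMap_cons]
        by_cases hx : x = c
        · subst hx
          rw [expand_of_ne _ _ fun u hu => mul_right_ne u x hu.symm]
          exact ⟨_, _, rfl, fun h => hp.1 x (by simp) rfl h.2⟩
        · obtain ⟨y, ys, h1, h2⟩ := expand_eq_cons hH c (hl x (by simp)) hx
          exact ⟨y, _, by rw [h1]; rfl, fun h => h2 h.1⟩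
      rw [hy] at ih' ⊢
      rw [collapseFrom, if_neg hyc]
      exact congrArg _ ih'

/-- The lists arising from decreasing lists of Hall trees by expanding the trees with right
child in `r`. -/
structure IsPartialFactorization (H : Set (FreeMagma A)) (lt : FreeMagma A → FreeMagma A → Prop)
    (N : ℕ) (r l : List (FreeMagma A)) : Prop where
  sub : ∀ t ∈ l, t ∈ H ∧ t.length ≤ N
  primitive : ∀ t ∈ l, t ∈ r → Primitive r t
  pairwise : l.Pairwise fun t x => x ∈ r ∨ x = t ∨ lt x t

variable {N : ℕ} {c : FreeMagma A} {r : List (FreeMagma A)}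

theorem IsLowerList.expand_of_notMem (hH : IsHallSet H lt) (h : IsLowerList H lt N (c :: r))
    {t : FreeMagma A} (ht : t ∈ H) (hN : t.length ≤ N) (htr : t ∉ r) : expand c t = [t] := by
  refine expand_of_ne _ _ fun x hx => htr ?_
  subst hx
  exact h.mem_tail hH ht hN (hH.of_mul ht).2.2.2

theorem IsLowerList.mem_expand (hH : IsHallSet H lt) (h : IsLowerList H lt N (c :: r))
    {t : FreeMagma A} (ht : t ∈ r) (hp : Primitive r t) :
    ∀ y ∈ expand c t, y ∈ c :: r ∧ Primitive (c :: r) y := by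
  induction t using FreeMagma.recOnMul with
  | ih1 a =>
    intro y hy
    rw [List.mem_singleton.1 hy]
    exact ⟨by simp [ht], fun u v huv => by cases huv⟩
  | ih2 u v ihu _ =>
    by_cases hv : v = c
    · subst hv
      obtain ⟨h1, h2⟩ := h.primitive_left hH ht
      intro y hy
      rw [expand_mul_self, List.mem_append, List.mem_singleton] at hy
      rcases hy with hy | rfl
      · exact ihu h1 h2 y hy
      · exact ⟨by simp, h.primitive_head hH⟩
    · have hne : ∀ x, u * v ≠ x * c := fun x hx => hv (tree_mul_inj hx).2
      intro y hy
      rw [expand_of_ne _ _ hne, List.mem_singleton] at hy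
      subst hy
      exact ⟨by simp [ht], hp.cons hne⟩

/-- Only trees of `r` are split, and into primitive trees of `c :: r`. Iterated from the empty list
to all Hall trees up to degree `N`, this turns a decreasing list into the list of its letters. -/
theorem IsPartialFactorization.expand (hH : IsHallSet H lt) (h : IsLowerList H lt N (c :: r))
    {l : List (FreeMagma A)} (hl : IsPartialFactorization H lt N r l) :
    IsPartialFactorization H lt N (c :: r) (l.flatMap (expand c)) := by
  have hnot : ∀ t ∈ l, t ∉ r → HallShuffle.expand c t = [t] := fun t ht htr =>
    h.expand_of_notMem hH (hl.sub t ht).1 (hl.sub t ht).2 htr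
  have hin : ∀ t ∈ l, t ∈ r → ∀ y ∈ HallShuffle.expand c t, y ∈ c :: r ∧ Primitive (c :: r) y :=
    fun t ht htr => h.mem_expand hH htr (hl.primitive t ht htr)
  refine ⟨fun y hy => ?_, fun y hy hyr => ?_, ?_⟩
  · obtain ⟨t, ht, hy⟩ := List.mem_flatMap.1 hy
    by_cases htr : t ∈ r
    · exact h.sub y (hin t ht htr y hy).1
    · rw [hnot t ht htr, List.mem_singleton] at hy
      exact hy ▸ hl.sub t ht
  · obtain ⟨t, ht, hy⟩ := List.mem_flatMap.1 hy
    by_cases htr : t ∈ r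
    · exact (hin t ht htr y hy).2
    · rw [hnot t ht htr, List.mem_singleton] at hy
      subst hy
      rcases List.mem_cons.1 hyr with rfl | hy
      · exact h.primitive_head hH
      · exact absurd hy htr
  · rw [List.pairwise_flatMap]
    refine ⟨fun t ht => ?_, hl.pairwise.imp_of_mem fun {t x} ht hx htx y hy z hz => ?_⟩
    · by_cases htr : t ∈ r
      · exact List.Pairwise.imp_of_mem (R := fun _ _ => True)
          (fun _ hy _ => Or.inl (hin t ht htr _ hy).1) (List.pairwise_of_forall fun _ _ => trivial)
      · rw [hnot t ht htr]
        exact List.pairwise_singleton _ _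
    · by_cases hxr : x ∈ r
      · exact Or.inl (hin x hx hxr z hz).1
      · rw [hnot x hx hxr, List.mem_singleton] at hz
        subst hz
        -- If the later tree is outside `r`, so is the earlier one, because `r` is a lower set; both
        -- are then unchanged and keep their order.
        have htr : t ∉ r := by
          intro htr
          rcases htx with h1 | rfl | h1
          · exact hxr h1
          · exact hxr htr
          · exact hxr ((h.tail hH).lower z (hl.sub z hx).1 (hl.sub z hx).2 t htr h1)
        rw [hnot t ht htr, List.mem_singleton] at hy
        subst hy
        exact Or.inr (htx.resolve_left hxr)

theorem IsPartialFactorization.collapse_expand (hH : IsHallSet H lt)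
    (h : IsLowerList H lt N (c :: r)) {l : List (FreeMagma A)}
    (hl : IsPartialFactorization H lt N r l) :
    collapse lt c (l.flatMap (HallShuffle.expand c)) = l := by
  refine collapse_flatMap_expand hH c (fun t ht => (hl.sub t ht).1)
    (hl.pairwise.imp_of_mem fun {t x} ht _ htx hxc => ?_)
  subst hxc
  rcases htx with h1 | rfl | h1
  · exact absurd h1 (h.head_notMem hH)
  · exact hH.irrefl _ h.head_mem
  · exact hH.asymm h.head_mem (hl.sub t ht).1 h1

/-- Partial factorizations of a word relative to a larger `r` determine the decreasing one. -/
theorem IsLowerList.eq_of_foliageProd_eq (hH : IsHallSet H lt) (h : IsLowerList H lt N r)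
    (hr : ∀ l l', IsPartialFactorization H lt N r l → IsPartialFactorization H lt N r l' →
      foliageProd l = foliageProd l' → l = l')
    {l l' : List (FreeMagma A)} (hl : IsPartialFactorization H lt N [] l)
    (hl' : IsPartialFactorization H lt N [] l') (heq : foliageProd l = foliageProd l') :
    l = l' := by
  induction r with
  | nil => exact hr l l' hl hl' heq
  | cons c r ih =>
    -- Expansion preserves the word and has `collapse` as a left inverse, so injectivity for `c ::
    -- r` passes to `r`.
    refine ih (h.tail hH) fun m m' hm hm' hmm => ?_
    rw [← hm.collapse_expand hH h, ← hm'.collapse_expand hH h,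
      hr _ _ (hm.expand hH h) (hm'.expand hH h)
        (by rw [foliageProd_flatMap_expand, foliageProd_flatMap_expand, hmm])]

theorem eq_of_foliageProd_eq_of_letters {l l' : List (FreeMagma A)}
    (hl : ∀ t ∈ l, ∃ a, t = FreeMagma.of a) (hl' : ∀ t ∈ l', ∃ a, t = FreeMagma.of a)
    (h : foliageProd l = foliageProd l') : l = l' := by
  have key : ∀ l : List (FreeMagma A), (∀ t ∈ l, ∃ a, t = FreeMagma.of a) →
      (FreeMonoid.toList (foliageProd l)).map FreeMagma.of = l := by
    intro l hl
    induction l with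
    | nil => rfl
    | cons t l ih =>
      obtain ⟨a, rfl⟩ := hl t (by simp)
      have h2 := ih fun s hs => hl s (by simp [hs])
      rw [foliageProd_cons]
      exact congrArg (FreeMagma.of a :: ·) h2
  rw [← key l hl, ← key l' hl', h]

/-- A word has at most one factorization as a decreasing product of Hall words. -/
theorem IsDecreasing.eq_of_foliageProd_eq [Finite A] (hH : IsHallSet H lt)
    {l l' : List (FreeMagma A)} (hl : IsDecreasing H lt l) (hl' : IsDecreasing H lt l')
    (h : foliageProd l = foliageProd l') : l = l' := by
  obtain ⟨r, hr⟩ := exists_isHallList hH (foliageProd l).length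
  have key : ∀ m, IsDecreasing H lt m → foliageProd m = foliageProd l →
      IsPartialFactorization H lt (foliageProd l).length [] m := fun m hm hml =>
    ⟨fun t ht => ⟨hm.1 t ht, hml ▸ length_le_of_mem ht⟩, fun t _ ht => by simp at ht,
      hm.2.imp fun h => Or.inr (h.elim Or.inr fun h => Or.inl h.symm)⟩
  refine hr.isLowerList.eq_of_foliageProd_eq hH (fun m m' hm hm' hmm => ?_)
    (key l hl rfl) (key l' hl' h.symm) h
  have hletter : ∀ m, IsPartialFactorization H lt (foliageProd l).length r m →
      ∀ t ∈ m, ∃ a, t = FreeMagma.of a := fun m hm t ht =>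
    have htr := (hr.mem_iff t).2 (hm.sub t ht)
    (hr.primitive_iff hH htr).1 (hm.primitive t ht htr)
  exact eq_of_foliageProd_eq_of_letters (hletter m hm) (hletter m' hm') hmm

end

section

open WordFun

variable {A : Type*} {H : Set (FreeMagma A)} {lt : FreeMagma A → FreeMagma A → Prop}
  {N : ℕ} {c : FreeMagma A} {r : List (FreeMagma A)}

/-! ### Expansion of words in decreasing products of Hall trees -/

open Classical in
/-- The product of divided shuffle powers dual to a decreasing product of Hall trees. -/
def dualList : List (FreeMagma A) → WordFun A ℝ
  | [] => 1
  | c :: l => ((l.count c + 1 : ℕ) : ℝ)⁻¹ • (dualFun c * dualList l)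

theorem dualList_singleton (t : FreeMagma A) : dualList [t] = dualFun t := by
  simp [dualList]

/-- The successive multiplicities divided out in `dualList` multiply to k!, which is the coefficient
in the exponential series. -/
theorem dualList_replicate_append (k : ℕ) (c : FreeMagma A) {l : List (FreeMagma A)}
    (hc : c ∉ l) :
    dualList (List.replicate k c ++ l) = ((k.factorial : ℝ)⁻¹) • (dualFun c ^ k * dualList l) := by
  classical
  induction k with
  | zero => simp
  | succ k ih =>
    rw [List.replicate_succ, List.cons_append, dualList, ih, List.count_append,
      List.count_replicate_self, List.count_eq_zero_of_not_mem hc, add_zero, mul_smul_comm,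
      smul_smul, ← mul_assoc, ← pow_succ', Nat.factorial_succ, Nat.cast_mul, mul_inv]

open Classical in
/-- The decreasing lists with entries in `r` and multiplicities at most `N`. -/
def decreasingLists (N : ℕ) : List (FreeMagma A) → Finset (List (FreeMagma A))
  | [] => {[]}
  | c :: r => (Finset.range (N + 1) ×ˢ decreasingLists N r).image
      fun p => List.replicate p.1 c ++ p.2

theorem mem_decreasingLists_cons {l : List (FreeMagma A)} :
    l ∈ decreasingLists N (c :: r) ↔
      ∃ k l', k ≤ N ∧ l' ∈ decreasingLists N r ∧ l = List.replicate k c ++ l' := by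
  simp only [decreasingLists, Finset.mem_image, Finset.mem_product, Finset.mem_range, Prod.exists]
  constructor
  · rintro ⟨k, l', ⟨h1, h2⟩, rfl⟩
    exact ⟨k, l', by omega, h2, rfl⟩
  · rintro ⟨k, l', h1, h2, rfl⟩
    exact ⟨k, l', ⟨by omega, h2⟩, rfl⟩

theorem mem_of_mem_decreasingLists {l : List (FreeMagma A)} (hl : l ∈ decreasingLists N r) :
    ∀ t ∈ l, t ∈ r := by
  induction r generalizing l with
  | nil =>
    rw [decreasingLists, Finset.mem_singleton] at hl
    simp [hl]
  | cons c r ih =>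
    obtain ⟨k, l', -, hl', rfl⟩ := mem_decreasingLists_cons.1 hl
    intro t ht
    rcases List.mem_append.1 ht with ht | ht
    · rw [List.eq_of_mem_replicate ht]; simp
    · exact List.mem_cons_of_mem _ (ih hl' t ht)

theorem pairwise_of_mem_decreasingLists (hr : r.Pairwise fun s t => lt t s)
    {l : List (FreeMagma A)} (hl : l ∈ decreasingLists N r) :
    l.Pairwise fun s t => lt t s ∨ s = t := by
  induction r generalizing l with
  | nil =>
    rw [decreasingLists, Finset.mem_singleton] at hl
    simp [hl]
  | cons c r ih =>
    obtain ⟨k, l', -, hl', rfl⟩ := mem_decreasingLists_cons.1 hl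
    rw [List.pairwise_cons] at hr
    refine List.pairwise_append.2 ⟨List.pairwise_replicate.2 (Or.inr (Or.inr rfl)),
      ih hr.2 hl', fun s hs t ht => ?_⟩
    rw [List.eq_of_mem_replicate hs]
    exact Or.inl (hr.1 t (mem_of_mem_decreasingLists hl' t ht))

theorem nil_mem_decreasingLists : [] ∈ decreasingLists N r := by
  induction r with
  | nil => simp [decreasingLists]
  | cons c r ih => exact mem_decreasingLists_cons.2 ⟨0, [], by omega, ih, rfl⟩

theorem singleton_mem_decreasingLists (hN : 0 < N) {t : FreeMagma A} (ht : t ∈ r) :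
    [t] ∈ decreasingLists N r := by
  induction r with
  | nil => simp at ht
  | cons c r ih =>
    rw [mem_decreasingLists_cons]
    rcases List.mem_cons.1 ht with rfl | ht
    · exact ⟨1, [], hN, nil_mem_decreasingLists, rfl⟩
    · exact ⟨0, [t], by omega, ih ht, rfl⟩

theorem pbwProd_replicate_append (k : ℕ) (c : FreeMagma A) (l : List (FreeMagma A)) :
    pbwProd (List.replicate k c ++ l) = bracketing c ^ k * pbwProd l := by
  simp [pbwProd]

theorem replicate_append_inj {c : FreeMagma A} {k k' : ℕ} {l l' : List (FreeMagma A)}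
    (hl : c ∉ l) (hl' : c ∉ l') (h : List.replicate k c ++ l = List.replicate k' c ++ l') :
    k = k' ∧ l = l' := by
  classical
  have h1 := congrArg (List.count c) h
  simp only [List.count_append, List.count_replicate_self, List.count_eq_zero_of_not_mem hl,
    List.count_eq_zero_of_not_mem hl', add_zero] at h1
  subst h1
  exact ⟨rfl, List.append_cancel_left h⟩

/-- Choosing a term from each exponential means choosing a multiplicity for each tree. Without
repetitions in `r`, distinct choices give distinct lists. -/
theorem treeExpProd_eq_sum (hr : r.Nodup) :
    treeExpProd N r = ∑ l ∈ decreasingLists N r, scal (dualList l) * const (pbwProd l) := by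
  classical
  induction r with
  | nil =>
    rw [decreasingLists, Finset.sum_singleton, dualList, scal_one, one_mul]
    rfl
  | cons c r ih =>
    rw [List.nodup_cons] at hr
    have hc : ∀ l ∈ decreasingLists N r, c ∉ l := fun l hl hcl =>
      hr.1 (mem_of_mem_decreasingLists hl c hcl)
    have h1 : treeExpProd N (c :: r) = treeExp N c * treeExpProd N r := by
      simp [treeExpProd]
    rw [h1, ih hr.2, decreasingLists, Finset.sum_image, Finset.sum_product, treeExp, expTrunc,
      Finset.sum_mul_sum]
    · refine Finset.sum_congr rfl fun k _ => Finset.sum_congr rfl fun l hl => ?_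
      rw [dualList_replicate_append k c (hc l hl), pbwProd_replicate_append, scal_smul, scal_mul,
        const_mul, (scal_commute _ _).mul_pow, scal_pow, const_pow, smul_mul_assoc, smul_mul_assoc]
      congr 1
      rw [mul_assoc, mul_assoc, ← mul_assoc (const _ ^ k), ← (scal_commute _ (const _ ^ k)).eq]
      simp only [mul_assoc]
    · rintro ⟨k, l⟩ hp ⟨k', l'⟩ hp' heq
      simp only [Finset.coe_product, Set.mem_prod, Finset.mem_coe] at hp hp'
      obtain ⟨rfl, rfl⟩ := replicate_append_inj (hc l hp.2) (hc l' hp'.2) heq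
      rfl

theorem IsHallList.nodup (hH : IsHallSet H lt) (h : IsHallList H lt N r) : r.Nodup :=
  h.sorted.imp_of_mem fun {s _} hs _ hst hne =>
    hH.irrefl s ((h.mem_iff s).1 hs).1 (by subst hne; exact hst)

theorem IsHallList.isDecreasing (h : IsHallList H lt N r) {l : List (FreeMagma A)}
    (hl : l ∈ decreasingLists N r) : IsDecreasing H lt l :=
  ⟨fun t ht => ((h.mem_iff t).1 (mem_of_mem_decreasingLists hl t ht)).1,
    pairwise_of_mem_decreasingLists h.sorted hl⟩

/-- The expansion of a word in decreasing products of Hall brackets. -/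
theorem IsHallList.ofWord_eq_sum (hH : IsHallSet H lt) (h : IsHallList H lt N r) (w : List A)
    (hw : w.length ≤ N) :
    ofWord (FreeMonoid.ofList w) = ∑ l ∈ decreasingLists N r, dualList l w • pbwProd l := by
  rw [← h.treeExpProd_apply hH w hw, treeExpProd_eq_sum (h.nodup hH), WordFun.sum_apply]
  exact Finset.sum_congr rfl fun l _ => scal_mul_const_apply _ _ _

/-! ### The pairing -/

/-- The pairing with a fixed left argument, as a linear map. -/
def pairingLin (f : WordAlg A) : WordAlg A →ₗ[ℝ] ℝ where
  toFun := pairing f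
  map_add' g h := by
    simp only [pairing, Finsupp.sum, MonoidAlgebra.coeff_add, Finsupp.add_apply, mul_add,
      Finset.sum_add_distrib]
  map_smul' c g := by
    simp only [pairing, Finsupp.sum, MonoidAlgebra.coeff_smul, Finsupp.smul_apply, smul_eq_mul,
      Finset.mul_sum, RingHom.id_apply]
    exact Finset.sum_congr rfl fun w _ => mul_left_comm _ _ _

theorem pairing_ofWord (f : WordAlg A) (w : FreeMonoid A) : pairing f (ofWord w) = f.coeff w := by
  classical
  simp only [pairing, ofWord, MonoidAlgebra.coeff_single, Finsupp.single_apply, Finsupp.sum,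
    mul_ite, mul_one, mul_zero]
  rw [Finset.sum_ite_eq]
  split_ifs with h
  · rfl
  · exact (Finsupp.notMem_support_iff.1 h).symm

theorem IsHallList.coeff_eq_sum (hH : IsHallSet H lt) (h : IsHallList H lt N r) (f : WordAlg A)
    (w : List A) (hw : w.length ≤ N) :
    f.coeff (FreeMonoid.ofList w) =
      ∑ l ∈ decreasingLists N r, dualList l w * pairing f (pbwProd l) := by
  rw [← pairing_ofWord, h.ofWord_eq_sum hH w hw]
  exact (map_sum (pairingLin f) _ _).trans
    (Finset.sum_congr rfl fun l _ => map_smul (pairingLin f) _ _)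

/-! ### The dual family -/

theorem IsDualPBW.unique [Finite A] (hH : IsHallSet H lt) {S S' : FreeMonoid A → WordAlg A}
    (hS : IsDualPBW H lt S) (hS' : IsDualPBW H lt S') : S = S' := by
  funext u
  ext w
  obtain ⟨r, hr⟩ := exists_isHallList hH (FreeMonoid.toList w).length
  have h1 := hr.coeff_eq_sum hH (S u) (FreeMonoid.toList w) le_rfl
  have h2 := hr.coeff_eq_sum hH (S' u) (FreeMonoid.toList w) le_rfl
  rw [FreeMonoid.ofList_toList] at h1 h2
  rw [h1, h2]
  refine Finset.sum_congr rfl fun l hl => ?_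
  have h3 := hS u _ l (hr.isDecreasing hl) rfl
  have h4 := hS' u _ l (hr.isDecreasing hl) rfl
  by_cases hu : u = foliageProd l
  · rw [h3.1 hu, h4.1 hu]
  · rw [h3.2 hu, h4.2 hu]

/-- In the expansion of a coefficient, unique factorization leaves only the list `[h]`, whose
coefficient function is `dualFun h`. -/
theorem IsDualPBW.apply_foliage [Finite A] (hH : IsHallSet H lt) {S : FreeMonoid A → WordAlg A}
    (hS : IsDualPBW H lt S) {h : FreeMagma A} (hh : h ∈ H) : S (foliage h) = dualTree h := by
  have hdec : IsDecreasing H lt [h] := ⟨by simpa using hh, List.pairwise_singleton _ _⟩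
  have hfol : foliageProd [h] = foliage h := mul_one _
  ext w
  -- The bound must cover both the word, so that it can be expanded, and `h`, so that `[h]` occurs
  -- in the sum.
  obtain ⟨r, hr⟩ := exists_isHallList hH (max (FreeMonoid.toList w).length h.length)
  have h1 := hr.coeff_eq_sum hH (S (foliage h)) (FreeMonoid.toList w) (le_max_left _ _)
  rw [FreeMonoid.ofList_toList] at h1
  rw [h1, Finset.sum_eq_single [h]]
  · rw [((hS (foliage h) _ [h] hdec rfl).1 hfol.symm), mul_one, dualList_singleton]
    rfl
  · intro l hl hne
    rw [(hS (foliage h) _ l (hr.isDecreasing hl) rfl).2, mul_zero]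
    intro heq
    exact hne ((hr.isDecreasing hl).eq_of_foliageProd_eq hH hdec (heq.symm.trans hfol.symm))
  · intro hne
    exact absurd (singleton_mem_decreasingLists (lt_max_of_lt_right h.length_pos)
      ((hr.mem_iff h).2 ⟨hh, le_max_right _ _⟩)) hne

end

section

open WordFun

variable {A : Type*} {H : Set (FreeMagma A)} {lt : FreeMagma A → FreeMagma A → Prop}

/-! ### Grading by length and existence of the dual family -/

theorem coeff_mul_eq_zero {m n : ℕ} {f g : WordAlg A}
    (hf : ∀ w : FreeMonoid A, w.length ≠ m → f.coeff w = 0)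
    (hg : ∀ w : FreeMonoid A, w.length ≠ n → g.coeff w = 0) (w : FreeMonoid A)
    (hw : w.length ≠ m + n) : (f * g).coeff w = 0 := by
  classical
  rw [MonoidAlgebra.coeff_mul]
  refine Finset.sum_eq_zero fun u _ => Finset.sum_eq_zero fun v _ => ?_
  beta_reduce
  split_ifs with h
  · by_cases hu : u.length = m
    · rw [hg v, mul_zero]
      rw [← h, FreeMonoid.length_mul] at hw
      omega
    · rw [hf u hu, zero_mul]
  · rfl

theorem coeff_bracketing_eq_zero (t : FreeMagma A) (w : FreeMonoid A) (hw : w.length ≠ t.length) :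
    (bracketing t).coeff w = 0 := by
  classical
  induction t using FreeMagma.recOnMul generalizing w with
  | ih1 a =>
    refine (Finsupp.single_apply).trans (if_neg ?_)
    rintro rfl
    exact hw rfl
  | ih2 s t hs ht =>
    rw [length_mul] at hw
    rw [bracketing_mul, MonoidAlgebra.coeff_sub, Finsupp.sub_apply,
      coeff_mul_eq_zero hs ht w hw, coeff_mul_eq_zero ht hs w (by omega), sub_zero]

theorem coeff_pbwProd_eq_zero (l : List (FreeMagma A)) (w : FreeMonoid A)
    (hw : w.length ≠ (foliageProd l).length) : (pbwProd l).coeff w = 0 := by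
  classical
  induction l generalizing w with
  | nil =>
    refine (Finsupp.single_apply).trans (if_neg ?_)
    rintro rfl
    exact hw rfl
  | cons t l ih =>
    rw [foliageProd_cons, FreeMonoid.length_mul, length_foliage] at hw
    have h : pbwProd (t :: l) = bracketing t * pbwProd l := by simp [pbwProd]
    rw [h, coeff_mul_eq_zero (coeff_bracketing_eq_zero t) ih w hw]

/-- For every word there is an element of the word algebra with the required pairings. -/
theorem exists_dual [Finite A] (hH : IsHallSet H lt) (u : FreeMonoid A) :
    ∃ f : WordAlg A, ∀ l, IsDecreasing H lt l →
      (u = foliageProd l → pairing f (pbwProd l) = 1) ∧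
      (u ≠ foliageProd l → pairing f (pbwProd l) = 0) := by
  classical
  set n := u.length with hn
  obtain ⟨r, hr⟩ := exists_isHallList hH n
  have hfin : {w : FreeMonoid A | w.length = n}.Finite := List.finite_length_eq A n
  let W : Finset (FreeMonoid A) := hfin.toFinset
  have hW : ∀ w, w ∈ W ↔ w.length = n := fun w => by simp [W]
  let L : Finset (List (FreeMagma A)) := {l ∈ decreasingLists n r | (foliageProd l).length = n}
  have hL : ∀ l ∈ L, IsDecreasing H lt l ∧ (foliageProd l).length = n := fun l hl => by
    rw [Finset.mem_filter] at hl
    exact ⟨hr.isDecreasing hl.1, hl.2⟩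
  let M : Matrix W L ℝ := fun w l => dualList l.1 (FreeMonoid.toList w.1)
  let B : Matrix L W ℝ := fun l w => (pbwProd l.1).coeff w.1
  -- Row w is the expansion of the word w; products of brackets of a degree other than n drop out by
  -- homogeneity.
  have hMB : M * B = 1 := by
    ext w v
    have h1 := hr.ofWord_eq_sum hH (FreeMonoid.toList w.1) ((hW w.1).1 w.2).le
    have h2 := congrArg (fun f : WordAlg A => f.coeff v.1) h1
    simp only [FreeMonoid.ofList_toList, MonoidAlgebra.coeff_sum, Finsupp.finsetSum_apply,
      MonoidAlgebra.coeff_smul, Finsupp.smul_apply, smul_eq_mul] at h2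
    rw [Matrix.mul_apply, Matrix.one_apply]
    have h3 : ∑ l : L, M w l * B l v = ∑ l ∈ L, dualList l (FreeMonoid.toList w.1) *
        (pbwProd l).coeff v.1 :=
      Finset.sum_coe_sort L fun l => dualList l (FreeMonoid.toList w.1) * (pbwProd l).coeff v.1
    rw [h3, Finset.sum_filter_of_ne, ← h2, ofWord, MonoidAlgebra.coeff_single,
      Finsupp.single_apply]
    · exact if_congr Subtype.ext_iff.symm rfl rfl
    · intro l _ hne
      by_contra hl
      refine hne ?_
      rw [coeff_pbwProd_eq_zero l v.1 (by rw [(hW v.1).1 v.2]; exact Ne.symm hl), mul_zero]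
  let φ : L → W := fun l => ⟨foliageProd l.1, (hW _).2 (hL l.1 l.2).2⟩
  have hφ : Function.Injective φ := fun l l' h => Subtype.ext <|
    (hL l.1 l.2).1.eq_of_foliageProd_eq hH (hL l'.1 l'.2).1 (Subtype.ext_iff.1 h)
  -- Unique factorization gives one inequality, and the rank of `M * B = 1` the other. Hence `M` and
  -- `B` are two-sided inverses, and every word of length n has a decreasing factorization.
  have hcard : Fintype.card L = Fintype.card W := by
    refine le_antisymm (Fintype.card_le_of_injective φ hφ) ?_
    calc Fintype.card W = (M * B).rank := by rw [hMB, Matrix.rank_one]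
      _ ≤ M.rank := Matrix.rank_mul_le_left M B
      _ ≤ Fintype.card L := M.rank_le_card_width
  have hBM : B * M = 1 := (Matrix.mul_eq_one_comm_of_card_eq _ _ _ hcard.symm).1 hMB
  have hφs : Function.Surjective φ := ((Fintype.bijective_iff_injective_and_card φ).2 ⟨hφ, hcard⟩).2
  obtain ⟨p, hp⟩ := hφs ⟨u, (hW u).2 rfl⟩
  have hpu : foliageProd p.1 = u := Subtype.ext_iff.1 hp
  -- The dual element is the column of `M` at the factorization `p` of `u`, so its pairings with
  -- degree-n products are entries of `B * M = 1`.
  let f : WordAlg A := MonoidAlgebra.ofCoeff (Finsupp.onFinset W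
    (fun w => if w ∈ W then dualList p.1 (FreeMonoid.toList w) else 0) (fun w hw => by
      by_contra h
      exact hw (if_neg h)))
  have hf : ∀ g : WordAlg A, pairing f g =
      ∑ w : W, g.coeff w.1 * dualList p.1 (FreeMonoid.toList w.1) := by
    intro g
    rw [pairing, Finsupp.onFinset_sum _ (fun w => zero_mul _), ← Finset.sum_coe_sort W]
    refine Finset.sum_congr rfl fun w _ => ?_
    rw [if_pos w.2, mul_comm]
  refine ⟨f, fun l hl => ?_⟩
  by_cases hln : (foliageProd l).length = n
  · obtain ⟨q, hq⟩ := hφs ⟨foliageProd l, (hW _).2 hln⟩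
    have hql : q.1 = l :=
      (hL q.1 q.2).1.eq_of_foliageProd_eq hH hl (Subtype.ext_iff.1 hq)
    have h1 : pairing f (pbwProd l) = (1 : Matrix L L ℝ) q p := by
      rw [hf, ← hBM, Matrix.mul_apply, ← hql]
    rw [h1, Matrix.one_apply]
    constructor
    · intro hu
      rw [if_pos]
      exact hφ (hq.trans (by rw [hp]; exact Subtype.ext hu.symm))
    · intro hu
      rw [if_neg]
      rintro rfl
      exact hu (by rw [← hpu, hql])
  · refine ⟨fun hu => absurd (by rw [hn, hu]) hln, fun _ => ?_⟩
    rw [hf]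
    refine Finset.sum_eq_zero fun w _ => ?_
    rw [coeff_pbwProd_eq_zero l w.1 (by rw [(hW w.1).1 w.2]; exact Ne.symm hln), zero_mul]

end

end HallShuffle

end

theorem mainTheorem2 {A : Type*} [Finite A] (H : Set (FreeMagma A))
    (lt : FreeMagma A → FreeMagma A → Prop) (hH : HallShuffle.IsHallSet H lt) :
    (∃! S : FreeMonoid A → HallShuffle.WordAlg A, HallShuffle.IsDualPBW H lt S) ∧
    ∀ S : FreeMonoid A → HallShuffle.WordAlg A, HallShuffle.IsDualPBW H lt S →
      ∀ h' h'' : FreeMagma A, h' * h'' ∈ H →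
        S (HallShuffle.foliage (h' * h'')) =
          (HallShuffle.lazardDepth (h' * h'') : ℝ) •
            HallShuffle.halfShuffle (S (HallShuffle.foliage h'))
              (S (HallShuffle.foliage h'')) := by
  refine ⟨?_, fun S hS h' h'' hh => ?_⟩
  · choose S hS using fun u => HallShuffle.exists_dual hH u
    have hdual : HallShuffle.IsDualPBW H lt S := by
      rintro u w l hl rfl
      exact hS u l hl
    exact ⟨S, hdual, fun S' hS' => hS'.unique hH hdual⟩
  · have hm := hH.of_mul hh
    rw [hS.apply_foliage hH hh, hS.apply_foliage hH hm.1, hS.apply_foliage hH hm.2.1,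
      HallShuffle.dualTree_mul]
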